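/- **Setting.** A parity game is a finite directed graph whose move relation is left-total, whose positions are partitioned between players $0$ and $1$, and whose positions carry priorities in $\mathbb{N}$. A play is won by the player with the parity of the largest priority seen infinitely often. A subgame is an induced subgraph with left-total move relation. For a subgame $G$ and a set $U$ of positions, $G\setminus U$ is the maximal subgame of $G$ avoiding $U$; $\mathrm{pre}^\wp_G(U)$ is the set of positions of $G$ from which player $\wp$ can force the play into $U$ in one move; $\mathrm{atr}^\wp_G(U)$ is the least set containing $U$ and closed under $\mathrm{pre}^\wp_G$; $\mathrm{Win}^\wp_G$ is the winning region of $\wp$ in $G$, that is, its largest $\wp$-dominion (a set that the opponent cannot leave and on which $\wp$ has a positional strategy all of whose plays against positional strategies are won by $\wp$); $\bar\wp=1-\wp$. **Algorithm.** The Recursive (Zielonka) algorithm $\mathrm{sol}(G)$ returns $(\emptyset,\emptyset)$ on the empty game. Otherwise let $p$ be the maximal priority of $G$, $\wp=p\bmod 2$, and let $G_L=G\setminus \mathrm{atr}^\wp_G(\{v: v \text{ has priority } p\})$ be the left subgame; it calls $\mathrm{sol}(G_L)=(W_L^0,W_L^1)$. If $\mathrm{pre}^{\bar\wp}_G(W_L^{\bar\wp})\subseteq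 W_L^{\bar\wp}$, it returns $W_L^{\bar\wp}$ for $\bar\wp$ and its complement in $G$ for $\wp$. Otherwise it calls $\mathrm{sol}(G_R)=(W_R^0,W_R^1)$ on the right subgame $G_R=G\setminus\mathrm{atr}^{\bar\wp}_G(W_L^{\bar\wp})$, and returns $W_R^\wp$ for $\wp$ and its complement in $G$ for $\bar\wp$. With memoization, each solved subgame is stored with its computed regions, and a call on a stored subgame returns the stored answer; the calls counted are then those whose subgame is not yet stored. **Core family.** For $k\ge 1$ the core game $G^C_k$ has the positions $\alpha_i,\beta_i,\gamma_i$ for $0\le i\le 2k$. Positions $\alpha_i$ and $\beta_i$ belong to player $i \bmod 2$, and $\gamma_i$ to player $(i+1)\bmod 2$. Their priorities are $2k+i+1$, $i$ and $i$, respectively. The moves are $\alpha_i\to\beta_i$; $\beta_i\to\gamma_i$; $\beta_i\to\alpha_{i-1}$ if $i>0$; $\gamma_i\to\gamma_i$; $\gamma_i\to\beta_i$; and $\gamma_i\to\alpha_{i+1}$ if $i<2k$. **Induced subgame tree.** Set $G_\varepsilon=G^C_k$. For a word $w\in\{L,R\}^{*}$ with $|w|\le k$ put, with $z=2(k-|w|)$,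 $$\hat G_{wL}=G_w\setminus\mathrm{atr}^1_{G_w}(\{\alpha_z\}),\qquad \hat G_{wR}=G_w\setminus\mathrm{atr}^0_{G_w}\big(\mathrm{Win}^0_{\hat G_{wL}}\big),$$ and, if $w\ne\varepsilon$, $G_w=\hat G_w\setminus\mathrm{atr}^0_{\hat G_w}(\{\alpha_{z+1}\})$. The induced subgame tree of $G^C_k$ consists of all $G_w$ with $|w|\le k$ and all $\hat G_w$ with $1\le|w|\le k+1$. **Theorem (Exponential Worst Case).** The number of distinct recursive calls executed by the Recursive algorithm, with or without memoization, on a game with $n$ positions is $\Omega(2^{n/6})$ in the worst case: there is $c>0$ such that for all sufficiently large $n$ some parity game with $n$ positions makes the algorithm, both without and with memoization, execute calls on at least $c\,2^{n/6}$ distinct subgames (the initial call included). The core family is a witness. For every $k\ge1$: 1. $G^C_k$ has $6k+3$ positions. 2. The induced subgame tree embeds in the recursion tree of the algorithm run on $G^C_k$: for $w=x_1\cdots x_m$ with $m\le k$, following the recursive calls $x_1,L,x_2,L,\dots,x_m,L$ leads to a call on $G_w$, and from there the call $x\in\{L,R\}$ is executed and is a call on $\hat G_{wx}$. 3. The induced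 subgame tree contains exactly $3(2^{k+1}-1)$ pairwise distinct subgames. 4. All of them occur as arguments of calls without memoization, and of executed (non-stored) calls with memoization. So both versions execute calls on at least $3(2^{k+1}-1)$ distinct subgames. -/

import Mathlib

open Filter

universe u

/-- A parity game on a finite set `V` of positions. Position `v` belongs to player `owner v`, the
move relation is left-total, and `prio v` is the priority of `v`. -/
structure ParityGame (V : Type u) where
  owner : V → Fin 2
  move : V → V → Prop
  move_total : ∀ v, ∃ w, move v w
  prio : V → ℕ

/-- The opponent of a player. -/
def opp (p : Fin 2) : Fin 2 := 1 - p

/-- The directions in the recursion tree: left and right recursive call. -/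
inductive Side where
  | L : Side
  | R : Side

namespace ParityGame

variable {V : Type u} [Fintype V] (G : ParityGame V)

/-! Subgames of `G` are induced by sets `S` of positions and are identified with them. All notions
below are relative to such a subgame `S`: only positions and moves inside `S` are considered. -/

/-- `S` induces a subgame: the restricted move relation is left-total. -/
def IsSubgame (S : Finset V) : Prop := ∀ v ∈ S, ∃ w ∈ S, G.move v w

open Classical in
/-- The positions of the maximal subgame contained in `S \ U`: the union of all subgames contained
in `S \ U` (which is itself a subgame). -/
noncomputable def remove (S U : Finset V) : Finset V :=
  (S \ U).filter fun v => ∃ T : Finset V, T ⊆ S \ U ∧ G.IsSubgame T ∧ v ∈ T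

open Classical in
/-- The `p`-predecessor of `U` in the subgame `S`. -/
noncomputable def pre (S : Finset V) (p : Fin 2) (U : Finset V) : Finset V :=
  S.filter fun v =>
    (G.owner v = p ∧ ∃ w ∈ S, G.move v w ∧ w ∈ U) ∨
    (G.owner v = opp p ∧ ∀ w ∈ S, G.move v w → w ∈ U)

open Classical in
/-- The `p`-attractor of `U` in the subgame `S`: the least set of positions of `S` that contains
`U ∩ S` and is closed under `p`-predecessors. -/
noncomputable def atr (S : Finset V) (p : Fin 2) (U : Finset V) : Finset V :=
  S.filter fun v => ∀ X : Finset V, U ∩ S ⊆ X → G.pre S p X ⊆ X → v ∈ X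

/-! ### Dominions and winning regions -/

/-- `σ` is a positional `p`-strategy on `D` (its values elsewhere are irrelevant). -/
def IsStrategy (D : Finset V) (p : Fin 2) (σ : V → V) : Prop :=
  ∀ v ∈ D, G.owner v = p → σ v ∈ D ∧ G.move v (σ v)

open Classical in
/-- The play from `v` in which player `p` follows `σ` and the opponent follows `τ`. -/
noncomputable def play (p : Fin 2) (σ τ : V → V) (v : V) : ℕ → V :=
  fun i => (fun u => if G.owner u = p then σ u else τ u)^[i] v

/-- `D` is a `p`-dominion of the subgame `S`: the opponent of `p` cannot leave `D`, and `p` has a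
positional strategy on `D` such that all plays in `D` against positional strategies of the opponent
have a priority (the maximal one seen infinitely often) of parity `p`. -/
def IsDominion (S : Finset V) (p : Fin 2) (D : Finset V) : Prop :=
  D ⊆ S ∧
  (∀ v ∈ D, G.owner v = opp p → ∀ w ∈ S, G.move v w → w ∈ D) ∧
  ∃ σ : V → V, G.IsStrategy D p σ ∧
    ∀ τ : V → V, G.IsStrategy D (opp p) τ →
      ∀ v ∈ D, limsup (fun i => G.prio (G.play p σ τ v i)) atTop % 2 = (p : ℕ)

open Classical in
/-- The winning region of player `p` in the subgame `S`: the largest `p`-dominion, given as the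
union of all `p`-dominions. -/
noncomputable def win (S : Finset V) (p : Fin 2) : Finset V :=
  S.filter fun v => ∃ D : Finset V, G.IsDominion S p D ∧ v ∈ D

/-! ### The Recursive algorithm -/

/-- The maximal priority of a (nonempty) subgame. -/
def maxPrio (S : Finset V) : ℕ := S.sup G.prio

/-- The player with the parity of the maximal priority. -/
def leader (S : Finset V) : Fin 2 := Fin.ofNat 2 (G.maxPrio S)

open Classical in
/-- The left subgame: remove the attractor, for the leading player, to the positions of maximal
priority. -/
noncomputable def left (S : Finset V) : Finset V :=
  G.remove S (G.atr S (G.leader S) (S.filter fun v => G.prio v = G.maxPrio S))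

/-- The right subgame: remove the `p`-attractor to `W`. -/
noncomputable def right (S W : Finset V) (p : Fin 2) : Finset V :=
  G.remove S (G.atr S p W)

open Classical in
/-- Player `p` cannot force in one move any position of `S` outside `W` into `W`. -/
def Stable (S W : Finset V) (p : Fin 2) : Prop := G.pre S p W \ W = ∅

theorem card_left_lt {S : Finset V} (hS : S ≠ ∅) : (G.left S).card < S.card := by
  classical
  obtain ⟨v, hv, hm⟩ := Finset.exists_mem_eq_sup S (Finset.nonempty_iff_ne_empty.mpr hS) G.prio
  apply Finset.card_lt_card
  refine ⟨fun x hx => ?_, fun h => ?_⟩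
  · simp only [left, remove, Finset.mem_filter, Finset.mem_sdiff] at hx
    exact hx.1.1
  · have hx := h hv
    simp only [left, remove, Finset.mem_filter, Finset.mem_sdiff] at hx
    refine hx.1.2 (Finset.mem_filter.mpr ⟨hv, fun X hX _ => hX ?_⟩)
    simp [hv, maxPrio, hm]

theorem card_right_lt {S W : Finset V} {p : Fin 2} (h : ¬ G.Stable S W p) :
    (G.right S W p).card < S.card := by
  classical
  obtain ⟨v, hv⟩ := Finset.nonempty_iff_ne_empty.mpr h
  rw [Finset.mem_sdiff] at hv
  have hvS : v ∈ S := (Finset.mem_filter.mp hv.1).1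
  apply Finset.card_lt_card
  refine ⟨fun x hx => ?_, fun h => ?_⟩
  · simp only [right, remove, Finset.mem_filter, Finset.mem_sdiff] at hx
    exact hx.1.1
  · have hx := h hvS
    simp only [right, remove, Finset.mem_filter, Finset.mem_sdiff] at hx
    refine hx.1.2 (Finset.mem_filter.mpr ⟨hvS, fun X hX hc => hc ?_⟩)
    have h1 := hv.1
    simp only [pre, Finset.mem_filter] at h1 ⊢
    refine ⟨hvS, h1.2.imp ?_ ?_⟩
    · rintro ⟨ho, w, hw, hm, hwW⟩
      exact ⟨ho, w, hw, hm, hX (Finset.mem_inter.mpr ⟨hwW, hw⟩)⟩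
    · rintro ⟨ho, h2⟩
      exact ⟨ho, fun w hw hm => hX (Finset.mem_inter.mpr ⟨h2 w hw hm, hw⟩)⟩

open Classical in
/-- The Recursive (Zielonka) algorithm; `sol S q` is the region computed for player `q`. -/
noncomputable def sol (S : Finset V) : Fin 2 → Finset V :=
  if hS : S = ∅ then fun _ => ∅
  else
    let p := G.leader S
    let WL := sol (G.left S)
    if hW : G.Stable S (WL (opp p)) (opp p) then
      fun q => if q = p then S \ WL (opp p) else WL (opp p)
    else
      let WR := sol (G.right S (WL (opp p)) (opp p))
      fun q => if q = p then WR p else S \ WR p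
termination_by S.card
decreasing_by
  · exact G.card_left_lt hS
  · exact G.card_right_lt hW

open Classical in
/-- The recursion tree of the algorithm run on `S`: the argument of the call reached from the call
on `S` by following the given path of left and right recursive calls, if these are executed. -/
noncomputable def callAt (S : Finset V) : List Side → Option (Finset V)
  | [] => some S
  | Side.L :: path => if S = ∅ then none else callAt (G.left S) path
  | Side.R :: path =>
      let p := G.leader S
      let W := G.sol (G.left S) (opp p)
      if S = ∅ ∨ G.Stable S W (opp p) then none else callAt (G.right S W (opp p)) path

/-- The distinct subgames on which the algorithm, run on the whole game, is called. -/
def calls : Set (Finset V) := {T | ∃ path, G.callAt Finset.univ path = some T}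

/-! ### The Recursive algorithm with memoization -/

/-- The collection of already solved subgames with their winning regions. -/
abbrev MemoTable (V : Type u) := Finset V → Option (Fin 2 → Finset V)

/-- The outcome of a call of the memoized algorithm: the computed regions, the updated table, and
the list of arguments of all calls executed (the call itself and those nested in it) whose argument
was not found in the table, so that it had to be solved. -/
structure MemoRun (V : Type u) where
  result : Fin 2 → Finset V
  table : MemoTable V
  solved : List (Finset V)

open Classical in
/-- The Recursive algorithm with memoization, called on `S` with the current table `t`. -/
noncomputable def solMemo (S : Finset V) (t : MemoTable V) : MemoRun V :=
  match t S with
  | some W => ⟨W, t, []⟩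
  | none =>
    if hS : S = ∅ then ⟨fun _ => ∅, Function.update t S (some fun _ => ∅), [S]⟩
    else
      let p := G.leader S
      let l := solMemo (G.left S) t
      let WL := l.result
      if hW : G.Stable S (WL (opp p)) (opp p) then
        let W : Fin 2 → Finset V := fun q => if q = p then S \ WL (opp p) else WL (opp p)
        ⟨W, Function.update l.table S (some W), S :: l.solved⟩
      else
        let r := solMemo (G.right S (WL (opp p)) (opp p)) l.table
        let WR := r.result
        let W : Fin 2 → Finset V := fun q => if q = p then WR p else S \ WR p
        ⟨W, Function.update r.table S (some W), S :: (l.solved ++ r.solved)⟩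
termination_by S.card
decreasing_by
  · exact G.card_left_lt hS
  · exact G.card_right_lt hW

/-- The distinct subgames actually solved by the memoized algorithm, run on the whole game with an
empty table. -/
def memoCalls : Set (Finset V) := {T | T ∈ (G.solMemo Finset.univ fun _ => none).solved}

end ParityGame

/-! ### The core family -/

/-- The positions `α i`, `β i`, `γ i`, for `0 ≤ i ≤ 2 k`. -/
inductive CorePos (k : ℕ) where
  | α : Fin (2 * k + 1) → CorePos k
  | β : Fin (2 * k + 1) → CorePos k
  | γ : Fin (2 * k + 1) → CorePos k
  deriving Fintype

namespace CorePos

variable {k : ℕ}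

def owner : CorePos k → Fin 2
  | α i => Fin.ofNat 2 i
  | β i => Fin.ofNat 2 i
  | γ i => Fin.ofNat 2 (i + 1)

def prio : CorePos k → ℕ
  | α i => 2 * k + i + 1
  | β i => i
  | γ i => i

def move : CorePos k → CorePos k → Prop
  | α i, β j => j = i
  | β i, γ j => j = i
  | β i, α j => (j : ℕ) + 1 = i
  | γ i, γ j => j = i
  | γ i, β j => j = i
  | γ i, α j => (j : ℕ) = i + 1
  | _, _ => False

end CorePos

/-- The core game of index `k`. -/
def coreGame (k : ℕ) : ParityGame (CorePos k) where
  owner := CorePos.owner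
  move := CorePos.move
  move_total := by
    rintro (i | i | i)
    · exact ⟨CorePos.β i, rfl⟩
    · exact ⟨CorePos.γ i, rfl⟩
    · exact ⟨CorePos.γ i, rfl⟩
  prio := CorePos.prio

/-! ### The induced subgame tree

Words over `{L, R}` are lists with the last letter of the word first: the word obtained from `w` by
appending `x` is `x :: w`. They are used for `w.length ≤ k` only. -/

/-- The singleton of the position `α z`, for `z ≤ 2 k`. -/
def alphaSet (k z : ℕ) : Finset (CorePos k) := {CorePos.α (Fin.ofNat (2 * k + 1) z)}

/-- The child in direction `x` of the subgame `S` with leading position `α z`. -/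
noncomputable def coreChild (k : ℕ) (S : Finset (CorePos k)) (z : ℕ) : Side → Finset (CorePos k)
  | Side.L => (coreGame k).remove S ((coreGame k).atr S 1 (alphaSet k z))
  | Side.R => (coreGame k).remove S ((coreGame k).atr S 0
      ((coreGame k).win
        ((coreGame k).remove S ((coreGame k).atr S 1 (alphaSet k z))) 0))

/-- The subgame `G_w` of the core game of index `k`. -/
noncomputable def treeGame (k : ℕ) : List Side → Finset (CorePos k)
  | [] => Finset.univ
  | x :: w =>
      let H := coreChild k (treeGame k w) (2 * (k - w.length)) x
      (coreGame k).remove H ((coreGame k).atr H 0 (alphaSet k (2 * (k - (w.length + 1)) + 1)))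

/-- The subgame `Ĝ_{w x}` of the core game of index `k`. -/
noncomputable def treeHat (k : ℕ) (w : List Side) (x : Side) : Finset (CorePos k) :=
  coreChild k (treeGame k w) (2 * (k - w.length)) x

/-- The induced subgame tree of the core game of index `k`, as a set of subgames: all `G_w` with
`|w| ≤ k`, and all `Ĝ_w` with `1 ≤ |w| ≤ k + 1`. -/
def inducedSubgameTree (k : ℕ) : Set (Finset (CorePos k)) :=
  {S | (∃ w : List Side, w.length ≤ k ∧ S = treeGame k w) ∨
    (∃ (w : List Side) (x : Side), w.length ≤ k ∧ S = treeHat k w x)}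

/-- The path in the recursion tree at which `G_w` occurs: `G_{w x}` is the left subgame of
`Ĝ_{w x}`, which is the `x`-subgame of `G_w`. -/
def treePath : List Side → List Side
  | [] => []
  | x :: w => treePath w ++ [x, Side.L]

/-! Put z = 2(k - |w|). The subgame G_w contains all positions of index at most z and, above z, only
some β- and γ-positions (`IsTreeShape`). Its top position α z has odd priority, so player 1 leads,
and the left call removes just α z and, if present, β (z+1). In the left child player 0 wins exactly
the positions of even index at least z: no α is left up there, so a play keeps its index. Player 1
wins the rest by climbing (`IsTreeShape.mem_win`). The right call is executed because α z moves into
player 0's region through β z, and its attractor also takes γ (z-1). When z > 0, α (z-1) is on top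
in either child; the next left call removes it and restores the same shape with z lowered by 2.
Hence both branches stay open at every level.

The branches never merge. The α-positions reveal the level of a node, and γ (z-1), which survives
only in the left child and is never removed later, records the letter chosen there
(`eq_of_γ_mem_iff`, `subtreeNode_injective`). Each word of length at most k contributes three nodes:
G_w and its two children.

Three general facts tie this to the algorithm. The tree is defined through winning regions, and
`sol_eq_win` shows that the algorithm computes them. Memoization skips a call only when its whole
recursion tree has been stored already, so no distinct subgame is lost (`calls_subset_memoCalls`).
The algorithm commutes with renaming positions (`sol_map`, `callAt_map`), so a general number of
positions is reached by adding isolated γ-positions inside a larger core game. This is why the index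
`K` of the ambient game and the depth `k` of the tree are kept apart. -/

namespace ParityGame

variable {V : Type u} [Fintype V] (G : ParityGame V)

/-! ### Attractors -/

theorem eq_or_eq_opp (p q : Fin 2) : q = p ∨ q = opp p := by
  revert p q; decide

theorem opp_opp (p : Fin 2) : opp (opp p) = p := by
  revert p; decide

theorem opp_ne (p : Fin 2) : opp p ≠ p := by
  revert p; decide

section Attractor

variable {G} {S U X : Finset V} {p : Fin 2} {v w : V}

theorem mem_pre : v ∈ G.pre S p U ↔ v ∈ S ∧
    ((G.owner v = p ∧ ∃ w ∈ S, G.move v w ∧ w ∈ U) ∨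
      (G.owner v = opp p ∧ ∀ w ∈ S, G.move v w → w ∈ U)) := by
  simp [pre]

theorem pre_mono (h : U ⊆ X) : G.pre S p U ⊆ G.pre S p X := by
  intro v hv
  rw [mem_pre] at hv ⊢
  refine ⟨hv.1, hv.2.imp ?_ ?_⟩
  · rintro ⟨ho, w, hw, hm, hwU⟩
    exact ⟨ho, w, hw, hm, h hwU⟩
  · rintro ⟨ho, hU⟩
    exact ⟨ho, fun w hw hm => h (hU w hw hm)⟩

open Classical in
theorem atr_subset_left : G.atr S p U ⊆ S := Finset.filter_subset _ _

theorem mem_atr_of_mem (hU : v ∈ U) (hS : v ∈ S) : v ∈ G.atr S p U := by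
  classical
  exact Finset.mem_filter.mpr ⟨hS, fun X hX _ => hX (by simp [hU, hS])⟩

theorem atr_subset (hU : ∀ v ∈ U, v ∈ S → v ∈ X) (hX : G.pre S p X ⊆ X) : G.atr S p U ⊆ X := by
  classical
  intro v hv
  refine (Finset.mem_filter.mp hv).2 X (fun x hx => ?_) hX
  simp only [Finset.mem_inter] at hx
  exact hU x hx.1 hx.2

theorem pre_atr_subset : G.pre S p (G.atr S p U) ⊆ G.atr S p U := by
  classical
  intro v hv
  refine Finset.mem_filter.mpr ⟨(mem_pre.mp hv).1, fun X hX hc => hc (pre_mono ?_ hv)⟩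
  refine atr_subset (fun x hx hxS => hX ?_) hc
  simp [hx, hxS]

/-- Outside a `p`-attractor, player `p` cannot move into it. -/
theorem not_mem_atr_of_move (hv : v ∈ S) (hvA : v ∉ G.atr S p U) (ho : G.owner v = p)
    (hw : w ∈ S) (hm : G.move v w) : w ∉ G.atr S p U := fun hwA =>
  hvA (pre_atr_subset (mem_pre.mpr ⟨hv, Or.inl ⟨ho, w, hw, hm, hwA⟩⟩))

theorem exists_move_not_mem_atr (hS : G.IsSubgame S) (hv : v ∈ S) (hvA : v ∉ G.atr S p U) :
    ∃ w ∈ S, w ∉ G.atr S p U ∧ G.move v w := by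
  rcases eq_or_eq_opp p (G.owner v) with ho | ho
  · obtain ⟨w, hw, hm⟩ := hS v hv
    exact ⟨w, hw, not_mem_atr_of_move hv hvA ho hw hm, hm⟩
  · by_contra! h
    refine hvA (pre_atr_subset (mem_pre.mpr ⟨hv, Or.inr ⟨ho, fun w hw hm => ?_⟩⟩))
    by_contra hwA
    exact h w hw hwA hm

open Classical in
theorem isSubgame_sdiff_atr (hS : G.IsSubgame S) : G.IsSubgame (S \ G.atr S p U) := by
  intro v hv
  rw [Finset.mem_sdiff] at hv
  obtain ⟨w, hw, hwA, hm⟩ := exists_move_not_mem_atr hS hv.1 hv.2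
  exact ⟨w, Finset.mem_sdiff.mpr ⟨hw, hwA⟩, hm⟩

open Classical in
theorem remove_atr (hS : G.IsSubgame S) : G.remove S (G.atr S p U) = S \ G.atr S p U := by
  ext v
  simp only [remove, Finset.mem_filter, and_iff_left_iff_imp]
  exact fun hv => ⟨_, subset_rfl, isSubgame_sdiff_atr hS, hv⟩

/-- The attractor is the union of finitely many stages, each adding the predecessors of the previous
one, and the rank is the first stage containing a position. Its descent turns the attractor, defined
as a least fixed point, into a positional strategy. -/
theorem exists_rank : ∃ r : V → ℕ, ∀ v ∈ G.atr S p U, v ∉ U →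
    (G.owner v = p ∧ ∃ w ∈ G.atr S p U, G.move v w ∧ r w < r v) ∨
      (G.owner v = opp p ∧ ∀ w ∈ S, G.move v w → w ∈ G.atr S p U ∧ r w < r v) := by
  classical
  set A : ℕ → Finset V := fun n => (fun X => X ∪ G.pre S p X)^[n] (U ∩ S) with hA
  have hsucc (n) : A (n + 1) = A n ∪ G.pre S p (A n) := Function.iterate_succ_apply' _ _ _
  have hmono : Monotone A := monotone_nat_of_le_succ fun n => by
    rw [hsucc]; exact Finset.subset_union_left
  have hsub (n) : A n ⊆ G.atr S p U := by
    induction n with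
    | zero =>
      intro v hv
      simp only [hA, Function.iterate_zero, id_eq, Finset.mem_inter] at hv
      exact mem_atr_of_mem hv.1 hv.2
    | succ n ih =>
      rw [hsucc]
      exact Finset.union_subset ih ((pre_mono ih).trans pre_atr_subset)
  -- Positions that never enter a stage get the default rank 0; `hmem` is applied only to positions
  -- in some stage.
  set r : V → ℕ := fun v => sInf {n | v ∈ A n} with hr
  have hmem {v} (h : ∃ n, v ∈ A n) : v ∈ A (r v) := Nat.sInf_mem (s := {n | v ∈ A n}) h
  have hle {v n} (h : v ∈ A n) : r v ≤ n := Nat.sInf_le h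
  have hex : G.atr S p U ⊆ Finset.univ.filter fun v => ∃ n, v ∈ A n := by
    refine atr_subset (fun v hv hvS => ?_) fun v hv => ?_
    · simp only [Finset.mem_filter, Finset.mem_univ, true_and]
      exact ⟨0, by simp [hA, hv, hvS]⟩
    · simp only [Finset.mem_filter, Finset.mem_univ, true_and]
      rw [mem_pre] at hv
      simp only [Finset.mem_filter, Finset.mem_univ, true_and] at hv
      -- By finiteness one stage contains every position that ever enters, so a predecessor of the
      -- union enters at the next stage.
      refine ⟨Finset.univ.sup r + 1, ?_⟩
      rw [hsucc]
      have hin {w} (h : ∃ n, w ∈ A n) : w ∈ A (Finset.univ.sup r) :=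
        hmono (Finset.le_sup (f := r) (Finset.mem_univ w)) (hmem h)
      refine Finset.mem_union_right _ (mem_pre.mpr ⟨hv.1, hv.2.imp ?_ ?_⟩)
      · rintro ⟨ho, w, hw, hm, h⟩
        exact ⟨ho, w, hw, hm, hin h⟩
      · rintro ⟨ho, h⟩
        exact ⟨ho, fun w hw hm => hin (h w hw hm)⟩
  refine ⟨r, fun v hv hvU => ?_⟩
  have hvr := hmem (Finset.mem_filter.mp (hex hv)).2
  rcases hn : r v with _ | n
  · rw [hn] at hvr
    simp [hA, hvU] at hvr
  · rw [hn, hsucc, Finset.mem_union] at hvr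
    have hvp : v ∈ G.pre S p (A n) := hvr.resolve_left fun h => by
      have := hle h
      omega
    refine (mem_pre.mp hvp).2.imp ?_ ?_
    · rintro ⟨ho, w, hw, hm, hwA⟩
      exact ⟨ho, w, hsub n hwA, hm, Nat.lt_succ_of_le (hle hwA)⟩
    · rintro ⟨ho, h⟩
      exact ⟨ho, fun w hw hm => ⟨hsub n (h w hw hm), Nat.lt_succ_of_le (hle (h w hw hm))⟩⟩

end Attractor

/-! ### Winning plays -/

/-- The play `π` is won by player `p`. -/
def Wins (p : Fin 2) (π : ℕ → V) : Prop :=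
  limsup (fun i => G.prio (π i)) atTop % 2 = (p : ℕ)

/-- `π` is an infinite path in `D` that is consistent with the strategy `σ` of player `p`. -/
def IsPath (D : Finset V) (p : Fin 2) (σ : V → V) (π : ℕ → V) : Prop :=
  ∀ i, π i ∈ D ∧ G.move (π i) (π (i + 1)) ∧ (G.owner (π i) = p → π (i + 1) = σ (π i))

/-- Dominions whose strategy wins all consistent infinite paths, not only those against positional
strategies. -/
def IsStrongDominion (S : Finset V) (p : Fin 2) (D : Finset V) : Prop :=
  D ⊆ S ∧
  (∀ v ∈ D, G.owner v = opp p → ∀ w ∈ S, G.move v w → w ∈ D) ∧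
  ∃ σ : V → V, G.IsStrategy D p σ ∧ ∀ π, G.IsPath D p σ π → G.Wins p π

section Wins

variable {G} {p : Fin 2} {π : ℕ → V} {D D' : Finset V} {σ σ' : V → V}

theorem isBoundedUnder_prio : IsBoundedUnder (· ≤ ·) atTop fun i => G.prio (π i) :=
  isBoundedUnder_of ⟨Finset.univ.sup G.prio, fun _ => Finset.le_sup (Finset.mem_univ _)⟩

theorem eventually_prio_le_limsup :
    ∀ᶠ i in atTop, G.prio (π i) ≤ limsup (fun i => G.prio (π i)) atTop := by
  filter_upwards [eventually_lt_of_limsup_lt (Nat.lt_succ_self _)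
    (isBoundedUnder_prio (G := G) (π := π))] with i hi
  exact Nat.le_of_lt_succ hi

/-- Priorities are bounded natural numbers: infinitely often they exceed limsup - 1, and eventually
they do not exceed the limsup. The value 0 is separate, having no predecessor. -/
theorem frequently_prio_eq_limsup :
    ∃ᶠ i in atTop, G.prio (π i) = limsup (fun i => G.prio (π i)) atTop := by
  rcases hm : limsup (fun i => G.prio (π i)) atTop with _ | m
  · refine Eventually.frequently ?_
    filter_upwards [eventually_prio_le_limsup (G := G) (π := π)] with i hi
    omega
  · have h := frequently_lt_of_lt_limsup (f := atTop) (u := fun i => G.prio (π i)) (b := m)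
      (by isBoundedDefault) (by omega)
    refine (h.and_eventually (eventually_prio_le_limsup (G := G) (π := π))).mono ?_
    intro i hi
    omega

theorem wins_of_frequently {m : ℕ} (hle : ∀ᶠ i in atTop, G.prio (π i) ≤ m)
    (hm : ∃ᶠ i in atTop, G.prio (π i) = m) (hp : m % 2 = (p : ℕ)) : G.Wins p π := by
  have h1 : m ≤ limsup (fun i => G.prio (π i)) atTop := by
    obtain ⟨i, hi, hi'⟩ := (hm.and_eventually (eventually_prio_le_limsup (G := G) (π := π))).exists
    omega
  obtain ⟨i, hi, hi'⟩ := ((frequently_prio_eq_limsup (G := G) (π := π)).and_eventually hle).exists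
  rw [Wins, ← hp]
  congr 1
  omega

omit [Fintype V] in
-- Winning is prefix-independent, so strategies may be analysed on a tail of the play only.
theorem wins_shift (n : ℕ) : G.Wins p (fun i => π (i + n)) ↔ G.Wins p π := by
  rw [Wins, limsup_nat_add (fun i => G.prio (π i)) n, Wins]

omit [Fintype V] in
theorem IsPath.shift (h : G.IsPath D p σ π) (n : ℕ) : G.IsPath D p σ fun i => π (i + n) := by
  intro i
  have := h (i + n)
  rwa [add_right_comm] at this

omit [Fintype V] in
theorem IsPath.restrict (h : G.IsPath D p σ π) (hD : ∀ i, π i ∈ D')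
    (hσ : ∀ v ∈ D', σ v = σ' v) : G.IsPath D' p σ' π := fun i =>
  ⟨hD i, (h i).2.1, fun ho => ((h i).2.2 ho).trans (hσ _ (hD i))⟩

omit [Fintype V] in
theorem exists_reach {A U : Finset V} {r : V → ℕ}
    (h : ∀ i, π i ∈ A → π i ∉ U → π (i + 1) ∈ A ∧ r (π (i + 1)) < r (π i)) {i : ℕ}
    (hi : π i ∈ A) : ∃ j ≥ i, π j ∈ U := by
  induction hn : r (π i) using Nat.strong_induction_on generalizing i with
  | _ n ih =>
    by_cases hU : π i ∈ U
    · exact ⟨i, le_rfl, hU⟩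
    · obtain ⟨h1, h2⟩ := h i hi hU
      obtain ⟨j, hj, hjU⟩ := ih _ (hn ▸ h2) h1 rfl
      exact ⟨j, by omega, hjU⟩

end Wins

/-! ### Dominions -/

section Dominion

variable {G} {S D E U W : Finset V} {p : Fin 2} {v : V}

omit [Fintype V] in
theorem IsStrongDominion.isDominion (h : G.IsStrongDominion S p D) : G.IsDominion S p D := by
  classical
  obtain ⟨hS, htrap, σ, hσ, hw⟩ := h
  refine ⟨hS, htrap, σ, hσ, fun τ hτ v hv => hw _ ?_⟩
  have hstep (i) : G.play p σ τ v (i + 1) =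
      if G.owner (G.play p σ τ v i) = p then σ (G.play p σ τ v i) else τ (G.play p σ τ v i) := by
    unfold play
    exact Function.iterate_succ_apply' _ _ _
  have hmem (i) : G.play p σ τ v i ∈ D := by
    induction i with
    | zero => exact hv
    | succ i ih =>
      rw [hstep]
      split_ifs with ho
      · exact (hσ _ ih ho).1
      · exact (hτ _ ih ((eq_or_eq_opp p _).resolve_left ho)).1
  refine fun i => ⟨hmem i, ?_, fun ho => by rw [hstep, if_pos ho]⟩
  rw [hstep]
  split_ifs with ho
  · exact (hσ _ (hmem i) ho).2
  · exact (hτ _ (hmem i) ((eq_or_eq_opp p _).resolve_left ho)).2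

omit [Fintype V] in
-- Playing the two strategies against each other from a common position gives a play that stays in
-- both sets and would be won by both players.
theorem IsDominion.notMem_of_isStrongDominion (hS : G.IsSubgame S) (hD : G.IsDominion S p D)
    (hE : G.IsStrongDominion S (opp p) E) (hv : v ∈ D) : v ∉ E := by
  classical
  intro hvE
  obtain ⟨hDS, hDtrap, σ, hσ, hDw⟩ := hD
  obtain ⟨hES, hEtrap, τ, hτ, hEw⟩ := hE
  rw [opp_opp] at hEtrap
  choose! s hs using hS
  -- The dominion `D` only promises to beat strategies defined on all of `D`, so `τ` is completed by
  -- arbitrary moves; the play stays in `E` and never uses them.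
  set τ' : V → V := fun u => if u ∈ E then τ u else s u with hτ'
  have hstrat : G.IsStrategy D (opp p) τ' := by
    intro u hu ho
    simp only [hτ']
    split_ifs with hE
    · exact ⟨hDtrap u hu ho _ (hES (hτ u hE ho).1) (hτ u hE ho).2, (hτ u hE ho).2⟩
    · exact ⟨hDtrap u hu ho _ (hs u (hDS hu)).1 (hs u (hDS hu)).2, (hs u (hDS hu)).2⟩
  set π := G.play p σ τ' v with hπ
  have hstep (i) : π (i + 1) = if G.owner (π i) = p then σ (π i) else τ' (π i) := by
    rw [hπ]
    unfold play
    exact Function.iterate_succ_apply' _ _ _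
  have hmem (i) : π i ∈ D ∧ π i ∈ E := by
    induction i with
    | zero => exact ⟨hv, hvE⟩
    | succ i ih =>
      rw [hstep]
      split_ifs with ho
      · have := hσ _ ih.1 ho
        exact ⟨this.1, hEtrap _ ih.2 ho _ (hDS this.1) this.2⟩
      · have ho := (eq_or_eq_opp p _).resolve_left ho
        exact ⟨(hstrat _ ih.1 ho).1, by simpa [hτ', ih.2] using (hτ _ ih.2 ho).1⟩
  have h1 := hDw τ' hstrat v hv
  have h2 : G.Wins (opp p) π := by
    refine hEw _ fun i => ⟨(hmem i).2, ?_, fun ho => ?_⟩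
    · rw [hstep]
      split_ifs with ho
      · exact (hσ _ (hmem i).1 ho).2
      · exact (hstrat _ (hmem i).1 ((eq_or_eq_opp p _).resolve_left ho)).2
    · rw [hstep, if_neg (ho ▸ opp_ne p)]
      simp [hτ', (hmem i).2]
  exact opp_ne p (Fin.val_injective (h2.symm.trans h1))

/-- A pair of opposing strong dominions covering the subgame certifies the winning region, since no
dominion of one player meets a strong one of the other. -/
theorem win_eq (hS : G.IsSubgame S) (hD : G.IsStrongDominion S p D)
    (hE : G.IsStrongDominion S (opp p) E) (h : ∀ v ∈ S, v ∉ E → v ∈ D) : G.win S p = D := by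
  classical
  ext v
  simp only [win, Finset.mem_filter]
  constructor
  · rintro ⟨hv, D', hD', hvD'⟩
    exact h v hv (hD'.notMem_of_isStrongDominion hS hE hvD')
  · exact fun hv => ⟨hD.1 hv, D, hD.isDominion, hv⟩

open Classical in
-- The opponent cannot enter the own attractor from outside, so putting it back opens no new escape
-- from `D`.
theorem IsStrongDominion.of_sdiff_atr
    (h : G.IsStrongDominion (S \ G.atr S (opp p) U) p D) : G.IsStrongDominion S p D := by
  obtain ⟨hD, htrap, hσ⟩ := h
  refine ⟨hD.trans Finset.sdiff_subset, fun v hv ho w hw hm => ?_, hσ⟩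
  obtain ⟨hvS, hvA⟩ := Finset.mem_sdiff.mp (hD hv)
  exact htrap v hv ho w (Finset.mem_sdiff.mpr ⟨hw, not_mem_atr_of_move hvS hvA ho hw hm⟩) hm

open Classical in
/-- The complement of a stable opponent region is a dominion of the leading player. -/
theorem isStrongDominion_sdiff_of_stable {m : ℕ}
    (hm : ∀ v ∈ S, G.prio v ≤ m) (hp : m % 2 = (p : ℕ)) (hU : ∀ v ∈ U, G.prio v = m)
    (hW : W ⊆ S \ G.atr S p U) (hst : G.pre S (opp p) W ⊆ W)
    (hD : G.IsStrongDominion (S \ G.atr S p U) p ((S \ G.atr S p U) \ W)) :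
    G.IsStrongDominion S p (S \ W) := by
  obtain ⟨hDS, hDtrap, σ, hσ, hDw⟩ := hD
  obtain ⟨r, hr⟩ := exists_rank (G := G) (S := S) (p := p) (U := U)
  set A := G.atr S p U with hA
  have hAW {v} (hv : v ∈ A) : v ∈ S \ W :=
    Finset.mem_sdiff.mpr ⟨atr_subset_left hv, fun h => (Finset.mem_sdiff.mp (hW h)).2 hv⟩
  -- A position of `p` with all its moves into `W` would be a predecessor of `W` for the opponent,
  -- against stability.
  have hout : ∀ v ∈ S \ W, G.owner v = p → ∃ w ∈ S \ W, G.move v w := by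
    intro v hv ho
    rw [Finset.mem_sdiff] at hv
    by_contra! h
    refine hv.2 (hst (mem_pre.mpr ⟨hv.1, Or.inr ⟨by rw [opp_opp, ho], fun w hw hvw => ?_⟩⟩))
    by_contra hwW
    exact h w (Finset.mem_sdiff.mpr ⟨hw, hwW⟩) hvw
  have hatt : ∀ v, v ∈ A ∧ v ∉ U ∧ G.owner v = p → ∃ w ∈ A, G.move v w ∧ r w < r v := by
    rintro v ⟨hv, hvU, ho⟩
    rcases hr v hv hvU with h | h
    · exact h.2
    · exact absurd (h.1.symm.trans ho) (opp_ne p)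
  choose! a ha using hatt
  choose! s hs using hout
  set σ' : V → V := fun v => if v ∈ A then if v ∈ U then s v else a v else σ v with hσ'
  refine ⟨Finset.sdiff_subset, fun v hv ho w hw hvw => ?_, σ', fun v hv ho => ?_, fun π hπ => ?_⟩
  · rw [Finset.mem_sdiff] at hv ⊢
    refine ⟨hw, fun hwW => hv.2 (hst (mem_pre.mpr ⟨hv.1, Or.inl ⟨ho, w, hw, hvw, hwW⟩⟩))⟩
  · simp only [hσ']
    split_ifs with h1 h2
    · exact hs v hv ho
    · exact ⟨hAW (ha v ⟨h1, h2, ho⟩).1, (ha v ⟨h1, h2, ho⟩).2.1⟩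
    · rw [Finset.mem_sdiff] at hv
      have := hσ v (by simp [hv, h1]) ho
      refine ⟨?_, this.2⟩
      have := this.1
      simp only [Finset.mem_sdiff] at this ⊢
      exact ⟨this.1.1, this.2⟩
  -- Each visit to the attractor is followed by one to `U`, so infinitely many visits make `m` the
  -- decisive priority. Otherwise a tail of the play follows `σ` in the left subgame.
  · by_cases hf : ∃ᶠ i in atTop, π i ∈ A
    · refine wins_of_frequently (Eventually.of_forall fun i => hm _
        (Finset.mem_sdiff.mp (hπ i).1).1) ?_ hp
      rw [frequently_atTop] at hf ⊢
      intro n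
      obtain ⟨i, hi, hiA⟩ := hf n
      have hdesc (i) (hi : π i ∈ A) (hiU : π i ∉ U) :
          π (i + 1) ∈ A ∧ r (π (i + 1)) < r (π i) := by
        rcases hr _ hi hiU with ⟨ho, -⟩ | ⟨ho, h⟩
        · rw [(hπ i).2.2 ho]
          have := ha _ ⟨hi, hiU, ho⟩
          simp only [hσ', hi, hiU, if_true, if_false]
          exact ⟨this.1, this.2.2⟩
        · exact h _ (Finset.mem_sdiff.mp (hπ (i + 1)).1).1 (hπ i).2.1
      obtain ⟨j, hj, hjU⟩ := exists_reach hdesc hiA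
      exact ⟨j, by omega, hU _ hjU⟩
    · rw [not_frequently, eventually_atTop] at hf
      obtain ⟨n, hn⟩ := hf
      rw [← wins_shift n]
      refine hDw _ ((hπ.shift n).restrict (fun i => ?_) fun v hv => ?_)
      · have := (hπ (i + n)).1
        have h2 := hn (i + n) (by omega)
        simp only [Finset.mem_sdiff] at this ⊢
        exact ⟨⟨this.1, h2⟩, this.2⟩
      · simp only [Finset.mem_sdiff] at hv
        simp [hσ', hv.1.2]

open Classical in
-- The strategy is composed of three: attract to `W`, win inside `W`, and use the strategy of the
-- remaining subgame as long as the play avoids the attractor.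
theorem isStrongDominion_sdiff_of_atr (hW : G.IsStrongDominion S p W)
    (hE : E ⊆ S \ G.atr S p W)
    (hD : G.IsStrongDominion (S \ G.atr S p W) p ((S \ G.atr S p W) \ E)) :
    G.IsStrongDominion S p (S \ E) := by
  obtain ⟨hWS, hWtrap, σ, hσ, hWw⟩ := hW
  obtain ⟨hDS, hDtrap, ρ, hρ, hDw⟩ := hD
  obtain ⟨r, hr⟩ := exists_rank (G := G) (S := S) (p := p) (U := W)
  set A := G.atr S p W with hA
  have hAE {v} (hv : v ∈ A) : v ∈ S \ E :=
    Finset.mem_sdiff.mpr ⟨atr_subset_left hv, fun h => (Finset.mem_sdiff.mp (hE h)).2 hv⟩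
  have hWA {v} (hv : v ∈ W) : v ∈ A := mem_atr_of_mem hv (hWS hv)
  have hatt : ∀ v, v ∈ A ∧ v ∉ W ∧ G.owner v = p → ∃ w ∈ A, G.move v w ∧ r w < r v := by
    rintro v ⟨hv, hvU, ho⟩
    rcases hr v hv hvU with h | h
    · exact h.2
    · exact absurd (h.1.symm.trans ho) (opp_ne p)
  choose! a ha using hatt
  set σ' : V → V := fun v => if v ∈ A then if v ∈ W then σ v else a v else ρ v with hσ'
  refine ⟨Finset.sdiff_subset, fun v hv ho w hw hvw => ?_, σ', fun v hv ho => ?_, fun π hπ => ?_⟩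
  · rw [Finset.mem_sdiff] at hv
    by_cases hwA : w ∈ A
    · exact hAE hwA
    by_cases hvA : v ∈ A
    · by_cases hvW : v ∈ W
      · exact hAE (hWA (hWtrap v hvW ho w hw hvw))
      · rcases hr v hvA hvW with h | h
        · exact absurd (ho.symm.trans h.1) (opp_ne p)
        · exact hAE (h.2 w hw hvw).1
    · exact Finset.mem_sdiff.mpr ⟨hw, (Finset.mem_sdiff.mp (hDtrap v (by simp [hv, hvA]) ho w
        (Finset.mem_sdiff.mpr ⟨hw, hwA⟩) hvw)).2⟩
  · simp only [hσ']
    split_ifs with h1 h2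
    · exact ⟨hAE (hWA (hσ v h2 ho).1), (hσ v h2 ho).2⟩
    · exact ⟨hAE (ha v ⟨h1, h2, ho⟩).1, (ha v ⟨h1, h2, ho⟩).2.1⟩
    · rw [Finset.mem_sdiff] at hv
      have := hρ v (by simp [hv, h1]) ho
      refine ⟨?_, this.2⟩
      have := this.1
      simp only [Finset.mem_sdiff] at this ⊢
      exact ⟨this.1.1, this.2⟩
  · have hπS (i) : π i ∈ S := (Finset.mem_sdiff.mp (hπ i).1).1
    -- A single visit suffices here: it leads to `W`, where the play then stays forever.
    by_cases hf : ∃ i, π i ∈ A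
    · obtain ⟨i, hi⟩ := hf
      have hdesc (i) (hi : π i ∈ A) (hiU : π i ∉ W) :
          π (i + 1) ∈ A ∧ r (π (i + 1)) < r (π i) := by
        rcases hr _ hi hiU with ⟨ho, -⟩ | ⟨ho, h⟩
        · rw [(hπ i).2.2 ho]
          have := ha _ ⟨hi, hiU, ho⟩
          simp only [hσ', hi, hiU, if_true, if_false]
          exact ⟨this.1, this.2.2⟩
        · exact h _ (hπS _) (hπ i).2.1
      obtain ⟨j, hj, hjW⟩ := exists_reach hdesc hi
      rw [← wins_shift j]
      refine hWw _ ((hπ.shift j).restrict (fun i => ?_) fun v hv => by simp [hσ', hv, hWA hv])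
      induction i with
      | zero => simpa using hjW
      | succ i ih =>
        rw [add_right_comm]
        rcases eq_or_eq_opp p (G.owner (π (i + j))) with ho | ho
        · rw [(hπ _).2.2 ho]
          simp only [hσ', ih, hWA ih, if_true]
          exact (hσ _ ih ho).1
        · exact hWtrap _ ih ho _ (hπS _) (hπ _).2.1
    · push Not at hf
      refine hDw _ (hπ.restrict (fun i => ?_) fun v hv => ?_)
      · have := (hπ i).1
        simp only [Finset.mem_sdiff] at this ⊢
        exact ⟨⟨this.1, hf i⟩, this.2⟩
      · simp only [Finset.mem_sdiff] at hv
        simp [hσ', hv.1.2]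

end Dominion

end ParityGame

namespace ParityGame

variable {V : Type u} [Fintype V] {G : ParityGame V} {S : Finset V}

/-! ### Correctness of the Recursive algorithm -/

theorem sol_empty : G.sol ∅ = fun _ => ∅ := by
  rw [sol]; simp

open Classical in
theorem sol_of_stable (hS : S ≠ ∅)
    (h : G.Stable S (G.sol (G.left S) (opp (G.leader S))) (opp (G.leader S))) :
    G.sol S = fun q => if q = G.leader S then S \ G.sol (G.left S) (opp (G.leader S))
      else G.sol (G.left S) (opp (G.leader S)) := by
  rw [sol, dif_neg hS]
  exact dif_pos h

open Classical in
theorem sol_of_not_stable (hS : S ≠ ∅)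
    (h : ¬ G.Stable S (G.sol (G.left S) (opp (G.leader S))) (opp (G.leader S))) :
    G.sol S = fun q =>
      let W := G.sol (G.right S (G.sol (G.left S) (opp (G.leader S))) (opp (G.leader S)))
        (G.leader S)
      if q = G.leader S then W else S \ W := by
  rw [sol, dif_neg hS]
  exact dif_neg h

open Classical in
theorem left_eq (hS : G.IsSubgame S) : G.left S =
    S \ G.atr S (G.leader S) (S.filter fun v => G.prio v = G.maxPrio S) := remove_atr hS

open Classical in
theorem right_eq (hS : G.IsSubgame S) (W : Finset V) (p : Fin 2) :
    G.right S W p = S \ G.atr S p W := remove_atr hS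

omit [Fintype V] in
theorem prio_le_maxPrio {v : V} (hv : v ∈ S) : G.prio v ≤ G.maxPrio S :=
  Finset.le_sup (f := G.prio) hv

open Classical in
/-- The Recursive algorithm computes a partition into dominions of the two players. -/
theorem isStrongDominion_sol (hS : G.IsSubgame S) (q : Fin 2) :
    G.IsStrongDominion S q (G.sol S q) ∧ S \ G.sol S q = G.sol S (opp q) := by
  induction hn : S.card using Nat.strong_induction_on generalizing S q with
  | _ n ih =>
    subst hn
    by_cases h0 : S = ∅
    · subst h0
      rw [sol_empty]
      exact ⟨⟨by simp, by simp, id, by simp [IsStrategy], fun π hπ => by simpa using (hπ 0).1⟩,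
        by simp⟩
    have ihL (q) := ih _ (G.card_left_lt h0) (S := G.left S) (by
      rw [left_eq hS]; exact isSubgame_sdiff_atr hS) q rfl
    set p := G.leader S with hp
    obtain ⟨W, hW⟩ : ∃ W, W = G.sol (G.left S) (opp p) := ⟨_, rfl⟩
    have hWL := (ihL (opp p)).1
    have hcompl := (ihL (opp p)).2
    have hDL := (ihL p).1
    rw [opp_opp] at hcompl
    rw [← hcompl] at hDL
    rw [← hW] at hWL hDL
    rw [left_eq hS] at hDL hWL
    have hWS : W ⊆ S := hWL.1.trans Finset.sdiff_subset
    have hWdom : G.IsStrongDominion S (opp p) W := by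
      refine IsStrongDominion.of_sdiff_atr (U := S.filter fun v => G.prio v = G.maxPrio S) ?_
      rwa [opp_opp]
    by_cases hst : G.Stable S W (opp p)
    · have hstable : G.IsStrongDominion S p (S \ W) := by
        refine isStrongDominion_sdiff_of_stable (fun v => prio_le_maxPrio) ?_ ?_ hWL.1
          (Finset.sdiff_eq_empty_iff_subset.mp hst) hDL
        · rw [hp]; rfl
        · exact fun v hv => (Finset.mem_filter.mp hv).2
      rw [sol_of_stable h0 (by rwa [← hp, ← hW]), ← hp, ← hW]
      rcases eq_or_eq_opp p q with rfl | rfl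
      · simp only [if_true, if_neg (opp_ne _)]
        exact ⟨hstable, Finset.sdiff_sdiff_eq_self hWS⟩
      · simp only [opp_opp, if_true, if_neg (opp_ne _)]
        exact ⟨hWdom, trivial⟩
    · have ihR (q) := ih _ (G.card_right_lt hst) (S := G.right S W (opp p)) (by
        rw [right_eq hS]; exact isSubgame_sdiff_atr hS) q rfl
      obtain ⟨E, hE⟩ : ∃ E, E = G.sol (G.right S W (opp p)) p := ⟨_, rfl⟩
      have hEdom := (ihR p).1
      have hD := (ihR (opp p)).1
      rw [← (ihR p).2, ← hE, right_eq hS] at hD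
      rw [← hE, right_eq hS] at hEdom
      have hES : E ⊆ S := hEdom.1.trans Finset.sdiff_subset
      have h1 : G.IsStrongDominion S (opp p) (S \ E) :=
        isStrongDominion_sdiff_of_atr hWdom hEdom.1 hD
      have h2 : G.IsStrongDominion S p E := hEdom.of_sdiff_atr
      rw [sol_of_not_stable h0 (by rwa [← hp, ← hW]), ← hp, ← hW]
      simp only
      rw [← hE]
      rcases eq_or_eq_opp p q with rfl | rfl
      · simp only [if_true, if_neg (opp_ne _)]
        exact ⟨h2, trivial⟩
      · simp only [opp_opp, if_true, if_neg (opp_ne _)]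
        exact ⟨h1, Finset.sdiff_sdiff_eq_self hES⟩

theorem sol_eq_win (hS : G.IsSubgame S) (q : Fin 2) : G.sol S q = G.win S q := by
  classical
  refine (win_eq hS (isStrongDominion_sol hS q).1 (isStrongDominion_sol hS (opp q)).1 ?_).symm
  intro v hv hvq
  rw [← (isStrongDominion_sol hS q).2, Finset.mem_sdiff] at hvq
  tauto

/-! ### Recursion trees -/

theorem callAt_append (path path' : List Side) :
    G.callAt S (path ++ path') = (G.callAt S path).bind fun T => G.callAt T path' := by
  classical
  induction path generalizing S with
  | nil => simp [callAt]
  | cons x path ih =>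
    cases x <;> simp only [List.cons_append, callAt] <;> split_ifs <;> simp [ih]

theorem callAt_left (hS : S ≠ ∅) (path : List Side) :
    G.callAt S (Side.L :: path) = G.callAt (G.left S) path := by
  rw [callAt, if_neg hS]

theorem callAt_right (hS : S ≠ ∅)
    (h : ¬ G.Stable S (G.sol (G.left S) (opp (G.leader S))) (opp (G.leader S)))
    (path : List Side) : G.callAt S (Side.R :: path) =
      G.callAt (G.right S (G.sol (G.left S) (opp (G.leader S))) (opp (G.leader S))) path := by
  rw [callAt]
  exact if_neg (not_or.mpr ⟨hS, h⟩)

/-! ### Memoization -/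

/-- Every stored entry is correct, and with a subgame its whole recursion tree is stored. -/
def MemoTable.IsValid (G : ParityGame V) (t : MemoTable V) : Prop :=
  ∀ T W, t T = some W → W = G.sol T ∧ ∀ path T', G.callAt T path = some T' → t T' ≠ none

/-- The recursion tree of `S` is `S` itself together with the trees of its children. The latter are
stored before `S` is, and the update supplies `S`. For a call that is not executed, `hL` or `hR` is
vacuous. -/
theorem MemoTable.IsValid.update {t t' : MemoTable V} [DecidableEq (Finset V)]
    (ht' : t'.IsValid G) (h : t' = t) {W : Fin 2 → Finset V} (hW : W = G.sol S)
    (hL : ∀ path T', G.callAt S (Side.L :: path) = some T' → t T' ≠ none)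
    (hR : ∀ path T', G.callAt S (Side.R :: path) = some T' → t T' ≠ none) :
    MemoTable.IsValid G (Function.update t S (some W)) := by
  subst h
  have hup {T} (h : t' T ≠ none) : Function.update t' S (some W) T ≠ none := by
    by_cases hT : T = S
    · simp [hT]
    · rwa [Function.update_of_ne hT]
  intro T W' hT
  by_cases hTS : T = S
  · subst hTS
    rw [Function.update_self, Option.some_inj] at hT
    refine ⟨hT ▸ hW, fun path T' h => ?_⟩
    rcases path with _ | ⟨_ | _, path⟩
    · simp only [callAt, Option.some_inj] at h
      simp [h]
    · exact hup (hL _ _ h)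
    · exact hup (hR _ _ h)
  · rw [Function.update_of_ne hTS] at hT
    exact ⟨(ht' T W' hT).1, fun path T' h => hup ((ht' T W' hT).2 path T' h)⟩

/-- The memoized algorithm is correct, stores the whole recursion tree of its argument, and solves
all subgames that it adds to the table. -/
theorem solMemo_spec (S : Finset V) (t : MemoTable V) (ht : t.IsValid G) :
    (G.solMemo S t).result = G.sol S ∧ (G.solMemo S t).table.IsValid G ∧
      (G.solMemo S t).table S ≠ none ∧
      (∀ T, t T ≠ none → (G.solMemo S t).table T ≠ none) ∧
      ∀ T, (G.solMemo S t).table T ≠ none → t T ≠ none ∨ T ∈ (G.solMemo S t).solved := by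
  classical
  induction hn : S.card using Nat.strong_induction_on generalizing S t with
  | _ n ih =>
    subst hn
    rw [solMemo]
    rcases hS : t S with _ | W
    swap
    · simp only
      exact ⟨(ht S W hS).1, ht, by simp [hS], fun _ h => h, fun _ h => Or.inl h⟩
    by_cases h0 : S = ∅
    · simp only [dif_pos h0]
      refine ⟨by rw [h0, sol_empty], ht.update rfl (by rw [h0, sol_empty]) ?_ ?_, by simp, ?_, ?_⟩
      · intro path T' h
        simp [callAt, h0] at h
      · intro path T' h
        simp [callAt, h0] at h
      · intro T hT
        by_cases hTS : T = S
        · simp [hTS]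
        · rwa [Function.update_of_ne hTS]
      · intro T hT
        by_cases hTS : T = S
        · simp [hTS]
        · rw [Function.update_of_ne hTS] at hT
          exact Or.inl hT
    obtain ⟨l1, l2, l3, l4, l5⟩ := ih _ (G.card_left_lt h0) (G.left S) t ht rfl
    simp only [dif_neg h0]
    set l := G.solMemo (G.left S) t with hl
    rw [l1]
    have hLpath (path T') (h : G.callAt S (Side.L :: path) = some T') : l.table T' ≠ none := by
      rw [callAt_left h0] at h
      obtain ⟨W, hW⟩ := Option.ne_none_iff_exists'.mp l3
      exact (l2 _ W hW).2 path T' h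
    by_cases hst : G.Stable S (G.sol (G.left S) (opp (G.leader S))) (opp (G.leader S))
    · rw [dif_pos hst]
      refine ⟨(sol_of_stable h0 hst).symm, l2.update rfl (sol_of_stable h0 hst).symm hLpath ?_,
        by simp, ?_, ?_⟩
      · intro path T' h
        simp [callAt, hst] at h
      · intro T hT
        by_cases hTS : T = S
        · simp [hTS]
        · simp only [Function.update_of_ne hTS]
          exact l4 T hT
      · intro T hT
        by_cases hTS : T = S
        · simp [hTS]
        · simp only [Function.update_of_ne hTS] at hT
          exact (l5 T hT).imp_right fun h => List.mem_cons_of_mem _ h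
    · rw [dif_neg hst]
      obtain ⟨r1, r2, r3, r4, r5⟩ := ih _ (G.card_right_lt hst) (G.right S _ _) l.table l2 rfl
      set r := G.solMemo (G.right S (G.sol (G.left S) (opp (G.leader S))) (opp (G.leader S)))
        l.table with hr
      simp only
      rw [r1]
      refine ⟨(sol_of_not_stable h0 hst).symm, r2.update rfl (sol_of_not_stable h0 hst).symm
        (fun path T' h => r4 _ (hLpath path T' h)) ?_, by simp, ?_, ?_⟩
      · intro path T' h
        rw [callAt_right h0 hst] at h
        obtain ⟨W, hW⟩ := Option.ne_none_iff_exists'.mp r3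
        exact (r2 _ W hW).2 path T' h
      · intro T hT
        by_cases hTS : T = S
        · simp [hTS]
        · simp only [Function.update_of_ne hTS]
          exact r4 T (l4 T hT)
      · intro T hT
        by_cases hTS : T = S
        · simp [hTS]
        · simp only [Function.update_of_ne hTS] at hT
          simp only [List.mem_cons, List.mem_append]
          rcases r5 T hT with h | h
          · rcases l5 T h with h | h <;> tauto
          · tauto

/-- The empty table is vacuously valid. At the end the whole recursion tree is stored, and whatever
was not stored initially must have been solved. -/
theorem calls_subset_memoCalls : G.calls ⊆ G.memoCalls := by
  rintro T ⟨path, hT⟩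
  obtain ⟨-, h2, h3, -, h5⟩ := solMemo_spec (G := G) Finset.univ (fun _ => none)
    (fun _ _ h => by simp at h)
  obtain ⟨W, hW⟩ := Option.ne_none_iff_exists'.mp h3
  exact (h5 T ((h2 _ W hW).2 path T hT)).resolve_left (by simp)

/-! ### Induced subgames as games -/

section Embedding

universe v

variable {V' : Type v} [Fintype V'] (G) {f : V' ↪ V}

/-- The game induced on a set of positions, with the positions renamed. -/
def induce (f : V' ↪ V) (h : G.IsSubgame (Finset.univ.map f)) : ParityGame V' where
  owner v := G.owner (f v)
  move v w := G.move (f v) (f w)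
  move_total v := by
    obtain ⟨w, hw, hm⟩ := h (f v) (by simp)
    obtain ⟨w, -, rfl⟩ := Finset.mem_map.mp hw
    exact ⟨w, hm⟩
  prio v := G.prio (f v)

variable {G} {h : G.IsSubgame (Finset.univ.map f)} {S U W : Finset V'} {p : Fin 2}

theorem pre_map : G.pre (S.map f) p (U.map f) = ((G.induce f h).pre S p U).map f := by
  ext v
  simp only [mem_pre, Finset.mem_map]
  constructor
  · rintro ⟨⟨v, hv, rfl⟩, h⟩
    refine ⟨v, ⟨hv, ?_⟩, rfl⟩
    simpa [induce] using h
  · rintro ⟨v, ⟨hv, h⟩, rfl⟩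
    refine ⟨⟨v, hv, rfl⟩, ?_⟩
    simpa [induce] using h

theorem atr_map : G.atr (S.map f) p (U.map f) = ((G.induce f h).atr S p U).map f := by
  classical
  apply subset_antisymm
  · refine atr_subset ?_ ?_
    · intro v hv hvS
      obtain ⟨v, hvU, rfl⟩ := Finset.mem_map.mp hv
      rw [Finset.mem_map'] at hvS ⊢
      exact mem_atr_of_mem hvU hvS
    · rw [pre_map (h := h)]
      exact Finset.map_subset_map.mpr pre_atr_subset
  · intro v hv
    obtain ⟨x, hx, rfl⟩ := Finset.mem_map.mp hv
    have key : (G.induce f h).atr S p U ⊆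
        Finset.univ.filter fun v => f v ∈ G.atr (S.map f) p (U.map f) := by
      refine atr_subset (fun v hvU hvS => ?_) fun v hv => ?_
      · simp only [Finset.mem_filter, Finset.mem_univ, true_and]
        exact mem_atr_of_mem (by simpa using hvU) (by simpa using hvS)
      · simp only [Finset.mem_filter, Finset.mem_univ, true_and]
        have := Finset.mem_map_of_mem f hv
        rw [← pre_map] at this
        refine pre_atr_subset (pre_mono ?_ this)
        intro w hw
        obtain ⟨y, hy, rfl⟩ := Finset.mem_map.mp hw
        exact (Finset.mem_filter.mp hy).2
    exact (Finset.mem_filter.mp (key hx)).2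

omit [Fintype V] in
theorem isSubgame_map : G.IsSubgame (S.map f) ↔ (G.induce f h).IsSubgame S := by
  simp [IsSubgame, induce]

omit [Fintype V] in
theorem remove_map : G.remove (S.map f) (U.map f) = ((G.induce f h).remove S U).map f := by
  classical
  ext v
  simp only [remove, Finset.mem_filter, Finset.mem_map, Finset.mem_sdiff]
  constructor
  · rintro ⟨⟨⟨v, hv, rfl⟩, hvU⟩, T, hT, hTs, hvT⟩
    have hvU' : v ∉ U := fun h => hvU ⟨v, h, rfl⟩
    -- A subgame inside the image of `S` is the image of its own preimage.
    obtain ⟨T, rfl⟩ : ∃ T' : Finset V', T = T'.map f := by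
      refine ⟨Finset.univ.filter fun v => f v ∈ T, ?_⟩
      ext w
      simp only [Finset.mem_map, Finset.mem_filter, Finset.mem_univ, true_and]
      constructor
      · intro hw
        obtain ⟨w, -, rfl⟩ := Finset.mem_map.mp (Finset.mem_sdiff.mp (hT hw)).1
        exact ⟨w, hw, rfl⟩
      · rintro ⟨w, hw, rfl⟩
        exact hw
    refine ⟨v, ⟨⟨hv, hvU'⟩, T, fun w hw => ?_, isSubgame_map.mp hTs, by simpa using hvT⟩, rfl⟩
    have := hT (Finset.mem_map_of_mem f hw)
    simpa using this
  · rintro ⟨v, ⟨⟨hv, hvU⟩, T, hT, hTs, hvT⟩, rfl⟩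
    refine ⟨⟨⟨v, hv, rfl⟩, by simpa using hvU⟩, T.map f, fun w hw => ?_, isSubgame_map.mpr hTs,
      by simpa using hvT⟩
    obtain ⟨x, hx, rfl⟩ := Finset.mem_map.mp hw
    simpa using hT hx

omit [Fintype V] in
theorem maxPrio_map : G.maxPrio (S.map f) = (G.induce f h).maxPrio S := Finset.sup_map _ _ _

omit [Fintype V] in
theorem leader_map : G.leader (S.map f) = (G.induce f h).leader S := by
  rw [leader, leader, maxPrio_map]

theorem left_map : G.left (S.map f) = ((G.induce f h).left S).map f := by
  classical
  rw [left, left, ← remove_map, ← atr_map, leader_map (h := h), maxPrio_map (h := h)]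
  congr 2
  ext v
  simp only [Finset.mem_filter, Finset.mem_map]
  constructor
  · rintro ⟨⟨v, hv, rfl⟩, hm⟩
    exact ⟨v, ⟨hv, hm⟩, rfl⟩
  · rintro ⟨v, ⟨hv, hm⟩, rfl⟩
    exact ⟨⟨v, hv, rfl⟩, hm⟩

theorem right_map :
    G.right (S.map f) (W.map f) p = ((G.induce f h).right S W p).map f := by
  rw [right, right, ← remove_map, ← atr_map]

theorem stable_map : G.Stable (S.map f) (W.map f) p ↔ (G.induce f h).Stable S W p := by
  classical
  simp only [Stable, Finset.sdiff_eq_empty_iff_subset]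
  rw [pre_map (h := h), Finset.map_subset_map]

theorem sol_map (q : Fin 2) : G.sol (S.map f) q = ((G.induce f h).sol S q).map f := by
  classical
  induction hn : S.card using Nat.strong_induction_on generalizing S q with
  | _ n ih =>
    subst hn
    have hsdiff (A B : Finset V') : (A \ B).map f = A.map f \ B.map f := by
      ext v
      simp only [Finset.mem_map, Finset.mem_sdiff]
      constructor
      · rintro ⟨v, hv, rfl⟩
        simpa using hv
      · rintro ⟨⟨v, hv, rfl⟩, h⟩
        exact ⟨v, ⟨hv, fun h' => h ⟨v, h', rfl⟩⟩, rfl⟩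
    by_cases h0 : S = ∅
    · simp [h0, sol_empty]
    have h0' : S.map f ≠ ∅ := by simpa using h0
    have hL := ih _ ((G.induce f h).card_left_lt h0) (S := (G.induce f h).left S)
      (opp (G.leader (S.map f))) rfl
    rw [← left_map] at hL
    by_cases hst : G.Stable (S.map f) (G.sol (G.left (S.map f)) (opp (G.leader (S.map f))))
      (opp (G.leader (S.map f)))
    · rw [sol_of_stable h0' hst]
      rw [hL, stable_map (h := h), leader_map (h := h)] at hst
      rw [sol_of_stable h0 hst, hL, leader_map (h := h)]
      simp only
      split_ifs <;> simp [hsdiff]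
    · rw [sol_of_not_stable h0' hst]
      rw [hL, stable_map (h := h), leader_map (h := h)] at hst
      rw [sol_of_not_stable h0 hst, hL, leader_map (h := h),
        right_map (h := h),        ih _ ((G.induce f h).card_right_lt hst) _ rfl]
      simp only
      split_ifs <;> simp [hsdiff]

theorem callAt_map (path : List Side) :
    G.callAt (S.map f) path = ((G.induce f h).callAt S path).map (·.map f) := by
  classical
  induction path generalizing S with
  | nil => simp [callAt]
  | cons x path ih =>
    cases x
    · simp only [callAt, Finset.map_eq_empty]
      rw [left_map (h := h), ih]
      split_ifs <;> simp
    · simp only [callAt, Finset.map_eq_empty]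
      rw [left_map (h := h), leader_map (h := h), sol_map (h := h), stable_map (h := h),
        right_map (h := h), ih]
      split_ifs <;> simp

/-- The calls of the algorithm, run on an induced subgame, are those in the game induced on it. -/
theorem ncard_callAt_induce :
    {T | ∃ path, G.callAt (Finset.univ.map f) path = some T}.ncard =
      (G.induce f h).calls.ncard := by
  rw [← Set.ncard_image_of_injective _ (Finset.map_injective f)]
  congr 1
  ext T
  simp [calls, callAt_map (h := h), Set.mem_image]
  constructor
  · rintro ⟨path, T', h, rfl⟩
    exact ⟨T', ⟨path, h⟩, rfl⟩
  · rintro ⟨T', ⟨path, h⟩, rfl⟩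
    exact ⟨path, T', h, rfl⟩

end Embedding

end ParityGame

/-! ### Owners, priorities and moves of the core game -/

namespace CorePos

variable {K : ℕ}

def index : CorePos K → ℕ
  | α i => i
  | β i => i
  | γ i => i

@[simp] theorem index_α (i : Fin (2 * K + 1)) : index (α i) = i := rfl
@[simp] theorem index_β (i : Fin (2 * K + 1)) : index (β i) = i := rfl
@[simp] theorem index_γ (i : Fin (2 * K + 1)) : index (γ i) = i := rfl

/-- Move from `β` to `γ`, and from `γ` to the next index. -/
def climb : CorePos K → CorePos K
  | α i => β i
  | β i => γ i
  | γ i => if h : (i : ℕ) + 1 < 2 * K + 1 then α ⟨i + 1, h⟩ else γ i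

@[simp] theorem prio_α (i : Fin (2 * K + 1)) : (coreGame K).prio (α i) = 2 * K + i + 1 := rfl
@[simp] theorem prio_β (i : Fin (2 * K + 1)) : (coreGame K).prio (β i) = i := rfl
@[simp] theorem prio_γ (i : Fin (2 * K + 1)) : (coreGame K).prio (γ i) = i := rfl

@[simp] theorem opp_zero : opp 0 = 1 := rfl
@[simp] theorem opp_one : opp 1 = 0 := rfl

@[simp] theorem owner_α_zero (i : Fin (2 * K + 1)) :
    (coreGame K).owner (α i) = 0 ↔ (i : ℕ) % 2 = 0 := by
  simp [coreGame, owner, Fin.ext_iff]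

@[simp] theorem owner_β_zero (i : Fin (2 * K + 1)) :
    (coreGame K).owner (β i) = 0 ↔ (i : ℕ) % 2 = 0 := by
  simp [coreGame, owner, Fin.ext_iff]

@[simp] theorem owner_γ_zero (i : Fin (2 * K + 1)) :
    (coreGame K).owner (γ i) = 0 ↔ (i : ℕ) % 2 = 1 := by
  simp [coreGame, owner, Fin.ext_iff]; omega

@[simp] theorem owner_α_one (i : Fin (2 * K + 1)) :
    (coreGame K).owner (α i) = 1 ↔ (i : ℕ) % 2 = 1 := by
  simp [coreGame, owner, Fin.ext_iff]

@[simp] theorem owner_β_one (i : Fin (2 * K + 1)) :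
    (coreGame K).owner (β i) = 1 ↔ (i : ℕ) % 2 = 1 := by
  simp [coreGame, owner, Fin.ext_iff]

@[simp] theorem owner_γ_one (i : Fin (2 * K + 1)) :
    (coreGame K).owner (γ i) = 1 ↔ (i : ℕ) % 2 = 0 := by
  simp [coreGame, owner, Fin.ext_iff]; omega

@[simp] theorem move_α {i : Fin (2 * K + 1)} {w : CorePos K} :
    (coreGame K).move (α i) w ↔ w = β i := by
  cases w <;> simp [coreGame, move]

@[simp] theorem move_β {i : Fin (2 * K + 1)} {w : CorePos K} :
    (coreGame K).move (β i) w ↔ w = γ i ∨ ∃ j : Fin (2 * K + 1), (j : ℕ) + 1 = i ∧ w = α j := by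
  cases w <;> simp [coreGame, move]

@[simp] theorem move_γ {i : Fin (2 * K + 1)} {w : CorePos K} :
    (coreGame K).move (γ i) w ↔
      w = γ i ∨ w = β i ∨ ∃ j : Fin (2 * K + 1), (j : ℕ) = i + 1 ∧ w = α j := by
  cases w <;> simp [coreGame, move]

theorem mem_alphaSet {z : ℕ} (hz : z ≤ 2 * K) {v : CorePos K} :
    v ∈ alphaSet K z ↔ v = α ⟨z, Nat.lt_succ_of_le hz⟩ := by
  simp [alphaSet, Fin.ofNat, Nat.mod_eq_of_lt (Nat.lt_succ_of_le hz)]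

end CorePos

/-! ### Explicit predecessors and the two shapes of subgames of the core game -/

namespace ParityGame

open CorePos

variable {K : ℕ} {S H : Finset (CorePos K)} {z : ℕ}

section Pre

variable {p : Fin 2} {X : Finset (CorePos K)} {i : Fin (2 * K + 1)}

theorem α_mem_pre : α i ∈ (coreGame K).pre S p X ↔ α i ∈ S ∧
    (((coreGame K).owner (α i) = p ∧ β i ∈ S ∧ β i ∈ X) ∨
      ((coreGame K).owner (α i) = opp p ∧ (β i ∈ S → β i ∈ X))) := by
  rw [mem_pre]
  simp only [move_α]
  grind

theorem β_mem_pre : β i ∈ (coreGame K).pre S p X ↔ β i ∈ S ∧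
    (((coreGame K).owner (β i) = p ∧ ((γ i ∈ S ∧ γ i ∈ X) ∨
        ∃ j : Fin (2 * K + 1), (j : ℕ) + 1 = i ∧ α j ∈ S ∧ α j ∈ X)) ∨
      ((coreGame K).owner (β i) = opp p ∧ (γ i ∈ S → γ i ∈ X) ∧
        ∀ j : Fin (2 * K + 1), (j : ℕ) + 1 = i → α j ∈ S → α j ∈ X)) := by
  rw [mem_pre]
  simp only [move_β]
  grind

theorem γ_mem_pre : γ i ∈ (coreGame K).pre S p X ↔ γ i ∈ S ∧
    (((coreGame K).owner (γ i) = p ∧ (γ i ∈ X ∨ (β i ∈ S ∧ β i ∈ X) ∨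
        ∃ j : Fin (2 * K + 1), (j : ℕ) = i + 1 ∧ α j ∈ S ∧ α j ∈ X)) ∨
      ((coreGame K).owner (γ i) = opp p ∧ γ i ∈ X ∧ (β i ∈ S → β i ∈ X) ∧
        ∀ j : Fin (2 * K + 1), (j : ℕ) = i + 1 → α j ∈ S → α j ∈ X)) := by
  rw [mem_pre]
  simp only [move_γ]
  grind

end Pre

open Classical in
-- This is the scheme for computing attractors: leastness gives one inclusion from `hU` and `hpre`,
-- and `hmem` is the other.
theorem mem_atr_iff {V : Type u} [Fintype V] {G : ParityGame V} {S U : Finset V} {p : Fin 2}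
    {P : V → Prop} (hU : ∀ v ∈ S, v ∈ U → P v)
    (hpre : ∀ v ∈ G.pre S p (S.filter P), P v) (hmem : ∀ v ∈ S, P v → v ∈ G.atr S p U) (v : V) :
    v ∈ G.atr S p U ↔ v ∈ S ∧ P v := by
  refine ⟨fun hv => Finset.mem_filter.mp (atr_subset (X := S.filter P) ?_ ?_ hv),
    fun hv => hmem v hv.1 hv.2⟩
  · exact fun v hv hvS => Finset.mem_filter.mpr ⟨hvS, hU v hvS hv⟩
  · exact fun v hv => Finset.mem_filter.mpr ⟨(mem_pre.mp hv).1, hpre v hv⟩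

/-- The left subgame, for a subgame whose position of maximal priority is `α z`. -/
theorem left_eq_of_top (hz : z ≤ 2 * K) (htop : α ⟨z, Nat.lt_succ_of_le hz⟩ ∈ S)
    (h : ∀ i, α i ∈ S → (i : ℕ) ≤ z) {p : Fin 2} (hp : (z + 1) % 2 = (p : ℕ)) :
    (coreGame K).leader S = p ∧
      (coreGame K).left S = (coreGame K).remove S ((coreGame K).atr S p (alphaSet K z)) := by
  classical
  -- Every α-priority exceeds 2K, which bounds all β- and γ-priorities, so the α of largest index is
  -- on top.
  have hprio : (coreGame K).maxPrio S = 2 * K + z + 1 := by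
    refine le_antisymm (Finset.sup_le fun v hv => ?_)
      (prio_le_maxPrio (G := coreGame K) htop)
    rcases v with i | i | i
    · have := h i hv
      simp; omega
    · simp; omega
    · simp; omega
  have hlead : (coreGame K).leader S = p := by
    rw [leader, hprio, Fin.ext_iff, ← hp]
    simp [Fin.ofNat]
    omega
  refine ⟨hlead, ?_⟩
  rw [left, hlead, hprio]
  congr 2
  ext v
  rw [Finset.mem_filter, mem_alphaSet hz]
  constructor
  · rintro ⟨hv, hm⟩
    rcases v with i | i | i
    · simp only [prio_α] at hm
      congr 1
      ext
      simp only
      omega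
    · simp at hm; omega
    · simp at hm; omega
  · rintro rfl
    exact ⟨htop, rfl⟩

/-- The shape of the subgames `G_w`: all positions of index at most `z`, and a tail without
`α`-positions. -/
structure IsTreeShape (z : ℕ) (S : Finset (CorePos K)) : Prop where
  even : z % 2 = 0
  le : z ≤ 2 * K
  low : ∀ i : Fin (2 * K + 1), (i : ℕ) ≤ z → α i ∈ S ∧ β i ∈ S ∧ γ i ∈ S
  high : ∀ i : Fin (2 * K + 1), z < i → α i ∉ S
  tail : ∀ i : Fin (2 * K + 1), z + 1 < i → β i ∈ S → γ i ∈ S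

/-- The shape of the subgames `Ĝ_w`. -/
structure IsHatShape (z : ℕ) (H : Finset (CorePos K)) : Prop where
  even : z % 2 = 0
  le : z ≤ 2 * K
  low : ∀ i : Fin (2 * K + 1), (i : ℕ) < z → α i ∈ H ∧ β i ∈ H
  low_γ : ∀ i : Fin (2 * K + 1), (i : ℕ) + 1 < z → γ i ∈ H
  high : ∀ i : Fin (2 * K + 1), z ≤ i → α i ∉ H
  tail : ∀ i : Fin (2 * K + 1), z ≤ i → β i ∈ H → γ i ∈ H

theorem IsTreeShape.isSubgame (h : IsTreeShape z S) : (coreGame K).IsSubgame S := by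
  rintro (i | i | i) hi
  · refine ⟨β i, (h.low i ?_).2.1, by simp⟩
    by_contra! hlt
    exact h.high i hlt hi
  · by_cases hγ : γ i ∈ S
    · exact ⟨γ i, hγ, by simp⟩
    have hz : (i : ℕ) = z + 1 := by
      have h1 := h.tail i
      have h2 := h.low i
      by_contra hne
      rcases lt_or_ge z i with h3 | h3
      · exact hγ (h1 (by omega) hi)
      · exact hγ (h2 h3).2.2
    exact ⟨α ⟨z, by omega⟩, (h.low _ le_rfl).1, by simp [hz]⟩
  · exact ⟨γ i, hi, by simp⟩

theorem IsHatShape.isSubgame (h : IsHatShape z H) : (coreGame K).IsSubgame H := by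
  rintro (i | i | i) hi
  · refine ⟨β i, (h.low i ?_).2, by simp⟩
    by_contra! hlt
    exact h.high i hlt hi
  · by_cases hγ : γ i ∈ H
    · exact ⟨γ i, hγ, by simp⟩
    have hz : (i : ℕ) + 1 = z := by
      by_contra hne
      rcases lt_or_ge (i : ℕ) z with h3 | h3
      · exact hγ (h.low_γ i (by omega))
      · exact hγ (h.tail i h3 hi)
    -- As z is even, i = z - 1 is odd and hence positive, so the exit α (i-1) exists.
    have := h.even
    exact ⟨α ⟨i - 1, by omega⟩, (h.low _ (by simp; omega)).1, by simp; omega⟩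
  · exact ⟨γ i, hi, by simp⟩

/-! ### The left child -/

/-- The positions attracted by player `1` to `α z`. -/
def LeftAttracted (z : ℕ) : CorePos K → Prop
  | α i => (i : ℕ) = z
  | β i => (i : ℕ) = z + 1
  | γ _ => False

/-- The odd-indexed β (z+1) belongs to player 1 and can move to α z. The γ-positions leading to α z
or β (z+1) belong to player 0 and escape by their self-loops, so attraction stops there. -/
theorem IsTreeShape.mem_atr_one (h : IsTreeShape z S) (v : CorePos K) :
    v ∈ (coreGame K).atr S 1 (alphaSet K z) ↔ v ∈ S ∧ LeftAttracted z v := by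
  have hev := h.even
  refine mem_atr_iff ?_ ?_ ?_ v
  · intro v _ hv
    rw [mem_alphaSet h.le] at hv
    simp [hv, LeftAttracted]
  · rintro (i | i | i) hi
    · have h1 := h.low i
      have h2 := h.high i
      simp [α_mem_pre, LeftAttracted] at hi ⊢
      grind
    · have h1 := h.low i
      have h2 := h.tail i
      simp [β_mem_pre, LeftAttracted] at hi ⊢
      grind
    · simp [γ_mem_pre, LeftAttracted] at hi
      grind
  · have htop : α ⟨z, by have := h.le; omega⟩ ∈ (coreGame K).atr S 1 (alphaSet K z) :=
      mem_atr_of_mem ((mem_alphaSet h.le).mpr rfl) (h.low _ le_rfl).1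
    rintro (i | i | i) hi hP
    · convert htop
      exact hP
    · refine pre_atr_subset (β_mem_pre.mpr ⟨hi, Or.inl ⟨?_, Or.inr ⟨_, ?_, ?_, htop⟩⟩⟩)
      · simp only [LeftAttracted] at hP
        simp; omega
      · exact hP.symm
      · exact (h.low _ le_rfl).1
    · exact hP.elim

theorem IsTreeShape.mem_coreChild_left (h : IsTreeShape z S) (v : CorePos K) :
    v ∈ coreChild K S z Side.L ↔ v ∈ S ∧ ¬ LeftAttracted z v := by
  classical
  rw [coreChild, remove_atr h.isSubgame, Finset.mem_sdiff, h.mem_atr_one]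
  tauto

theorem IsTreeShape.isHatShape_left (h : IsTreeShape z S) :
    IsHatShape z (coreChild K S z Side.L) where
  even := h.even
  le := h.le
  low i hi := by
    have := h.low i hi.le
    simp [h.mem_coreChild_left, LeftAttracted, this]; omega
  low_γ i hi := by
    have := h.low i (by omega)
    simp [h.mem_coreChild_left, LeftAttracted, this]
  high i hi := by
    have := h.high i
    simp [h.mem_coreChild_left, LeftAttracted]; grind
  tail i hi := by
    have := h.tail i
    have := h.low i
    simp [h.mem_coreChild_left, LeftAttracted]; grind

/-! ### Winning regions -/

open Classical in
-- At an even index from z on, player 0 moves from β to γ, and player 1 at γ can only loop or return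
-- to β, because every α up there is gone. The priority is constantly that even index.
theorem IsHatShape.isStrongDominion_zero (h : IsHatShape z H) :
    (coreGame K).IsStrongDominion H 0 (H.filter fun v => z ≤ v.index ∧ v.index % 2 = 0) := by
  refine ⟨Finset.filter_subset _ _, ?_, climb, ?_, ?_⟩
  · rintro (i | i | i) hi ho w hw hm
    · simp at hi ho; omega
    · simp at hi ho; omega
    · simp only [Finset.mem_filter, index_γ] at hi ⊢
      rw [move_γ] at hm
      rcases hm with rfl | rfl | ⟨j, hj, rfl⟩
      · exact ⟨hw, hi.2⟩
      · exact ⟨hw, hi.2⟩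
      · exact absurd hw (h.high j (by omega))
  · rintro (i | i | i) hi ho
    · simp at hi
      exact absurd hi.1 (h.high i (by omega))
    · simp at hi ⊢
      have := h.tail i
      simp [climb]; grind
    · simp at hi ho; omega
  · intro π hπ
    have hstep (t) : (coreGame K).prio (π t) = (coreGame K).prio (π 0) := by
      induction t with
      | zero => rfl
      | succ t ih =>
        rw [← ih]
        have h0 := (hπ t).1
        have h1 := (hπ (t + 1)).1
        have hm := (hπ t).2.1
        rcases ht : π t with i | i | i <;> rcases ht' : π (t + 1) with j | j | j <;>
          rw [ht] at h0 hm <;> rw [ht'] at h1 hm <;> simp at h0 h1 hm ⊢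
        all_goals first
          | exact absurd h1.1 (h.high j (by omega))
          | exact absurd h0.1 (h.high i (by omega))
          | rw [hm]
    refine wins_of_frequently (m := (coreGame K).prio (π 0))
      (Eventually.of_forall fun t => (hstep t).le)
      (Eventually.of_forall hstep).frequently ?_
    have h0 := (hπ 0).1
    rcases ht : π 0 with i | i | i <;> rw [ht] at h0 <;> simp at h0 ⊢
    · exact absurd h0.1 (h.high i (by omega))
    · exact h0.2.2
    · exact h0.2.2

open Classical in
-- Player 1 climbs. An even priority cannot be the largest recurring one: after an even β or γ a
-- higher α follows, and from an odd α player 0 must either raise the maximum or remain at that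
-- index forever. The hypothesis on γ is needed at β (z-1), where the right child has lost γ (z-1).
theorem IsHatShape.isStrongDominion_one (h : IsHatShape z H)
    (hγ : ∀ i : Fin (2 * K + 1), (i : ℕ) < z → γ i ∈ H) :
    (coreGame K).IsStrongDominion H 1 (H.filter fun v => v.index < z ∨ v.index % 2 = 1) := by
  have hev := h.even
  have hle := h.le
  refine ⟨Finset.filter_subset _ _, ?_, climb, ?_, ?_⟩
  · rintro (i | i | i) hi ho w hw hm
    · rw [move_α] at hm
      subst hm
      simp at hi ⊢
      exact ⟨hw, hi.2⟩
    · rw [move_β] at hm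
      rcases hm with rfl | ⟨j, hj, rfl⟩
      · simp at hi ⊢
        exact ⟨hw, hi.2⟩
      · simp at hi ho ⊢
        exact ⟨hw, by omega⟩
    · rw [move_γ] at hm
      rcases hm with rfl | rfl | ⟨j, hj, rfl⟩
      · exact hi
      · simp at hi ⊢
        exact ⟨hw, hi.2⟩
      · have hj' := h.high j
        simp at hi ho ⊢
        refine ⟨hw, Or.inl ?_⟩
        by_contra! hlt
        exact hj' hlt hw
  · rintro (i | i | i) hi ho
    · have := h.low i
      have := h.high i
      simp [climb] at hi ho ⊢
      grind
    · have := hγ i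
      have := h.tail i
      simp [climb] at hi ho ⊢
      grind
    · simp at hi ho
      have hi' : (i : ℕ) + 1 < 2 * K + 1 := by omega
      have := h.low ⟨i + 1, hi'⟩
      simp [climb, show (i : ℕ) < 2 * K by omega] at this ⊢
      exact ⟨(this (by omega)).1, by omega⟩
  · intro π hπ
    set m := limsup (fun i => (coreGame K).prio (π i)) atTop with hm
    have hfreq := frequently_prio_eq_limsup (G := coreGame K) (π := π)
    have hev := eventually_prio_le_limsup (G := coreGame K) (π := π)
    rw [← hm] at hfreq hev
    rw [eventually_atTop] at hev
    rw [frequently_atTop] at hfreq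
    obtain ⟨N, hN⟩ := hev
    obtain ⟨t₀, ht₀, htm⟩ := hfreq N
    change m % 2 = 1
    -- from a `γ` of even index, the play moves up
    have hup (t) (i) (ht : π t = γ i) (hi : (i : ℕ) % 2 = 0) :
        2 * K < (coreGame K).prio (π (t + 1)) := by
      have h0 := (hπ t).1
      have h1 := (hπ t).2.2
      rw [ht] at h0 h1
      simp at h0
      rw [h1 (by simpa using hi)]
      simp [climb, show (i : ℕ) < 2 * K by omega]
    rcases ht : π t₀ with j | i | i <;> rw [ht] at htm <;> simp at htm
    · by_contra hodd
      have hj : (j : ℕ) % 2 = 1 := by omega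
      -- Leaving γ j upwards would exceed the maximum m, and player 1 never descends from β j. So m
      -- would not recur.
      have hstay (t) : π (t₀ + t + 1) = β j ∨ π (t₀ + t + 1) = γ j := by
        induction t with
        | zero =>
          have := (hπ t₀).2.1
          rw [ht, move_α] at this
          exact Or.inl this
        | succ t ih =>
          rw [← add_assoc]
          rcases ih with ih | ih
          · have := (hπ (t₀ + t + 1)).2.2
            rw [ih] at this
            exact Or.inr (this (by simpa using hj))
          · have := (hπ (t₀ + t + 1)).2.1
            rw [ih, move_γ] at this
            rcases this with h | h | ⟨j', hj', h⟩
            · exact Or.inr h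
            · exact Or.inl h
            · have := hN (t₀ + t + 1 + 1) (by omega)
              rw [h] at this
              simp at this
              omega
      obtain ⟨t, ht, htm'⟩ := hfreq (t₀ + 1)
      obtain ⟨s, rfl⟩ := Nat.exists_eq_add_of_le ht
      have := hstay s
      rw [add_right_comm] at this
      rcases this with h | h <;> rw [h] at htm' <;> simp at htm' <;> omega
    · by_contra hodd
      have h1 := (hπ t₀).2.1
      rw [ht, move_β] at h1
      rcases h1 with h1 | ⟨j, hj, h1⟩
      · have h2 := hup _ i h1 (by omega)
        have h3 := hN (t₀ + 1 + 1) (by omega)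
        omega
      · have h3 := hN (t₀ + 1) (by omega)
        rw [h1] at h3
        simp at h3
        omega
    · by_contra hodd
      have h2 := hup _ i ht (by omega)
      have h3 := hN (t₀ + 1) (by omega)
      omega

theorem IsTreeShape.mem_win (h : IsTreeShape z S) (v : CorePos K) :
    v ∈ (coreGame K).win (coreChild K S z Side.L) 0 ↔
      v ∈ coreChild K S z Side.L ∧ z ≤ v.index ∧ v.index % 2 = 0 := by
  classical
  have hH := h.isHatShape_left
  rw [win_eq hH.isSubgame hH.isStrongDominion_zero (hH.isStrongDominion_one fun i hi => ?_),
    Finset.mem_filter]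
  · intro v hv hv'
    simp only [Finset.mem_filter, hv, true_and] at hv' ⊢
    omega
  · simp [h.mem_coreChild_left, LeftAttracted, h.low i hi.le]

/-! ### The right child -/

/-- The positions attracted by player `0` to its winning region of the left child. -/
def RightAttracted (z : ℕ) (S : Finset (CorePos K)) : CorePos K → Prop
  | α i => (i : ℕ) = z
  | β i => (z ≤ i ∧ (i : ℕ) % 2 = 0) ∨ ((i : ℕ) = z + 1 ∧ γ i ∉ S)
  | γ i => (z ≤ i ∧ (i : ℕ) % 2 = 0) ∨ (i : ℕ) + 1 = z

/-- Player 0 moves from α z to β z and from γ (z-1) to α z. Player 1's β (z+1) falls only if γ (z+1)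
is missing, for then α z is its sole exit. -/
theorem IsTreeShape.mem_atr_zero (h : IsTreeShape z S) (v : CorePos K) :
    v ∈ (coreGame K).atr S 0 ((coreGame K).win (coreChild K S z Side.L) 0) ↔
      v ∈ S ∧ RightAttracted z S v := by
  have hev := h.even
  have hle := h.le
  refine mem_atr_iff ?_ ?_ ?_ v
  · rintro (i | i | i) hi hv
    all_goals
      rw [h.mem_win, h.mem_coreChild_left] at hv
      simp [LeftAttracted, RightAttracted] at hv ⊢
    · have := h.high i; grind
    · omega
    · omega
  · rintro (i | i | i) hi
    · have h1 := h.low i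
      have h2 := h.high i
      simp [α_mem_pre, RightAttracted] at hi ⊢
      grind
    · have h1 := h.low i
      have h2 := h.tail i
      by_contra hP
      simp [RightAttracted] at hP
      simp [β_mem_pre, RightAttracted] at hi
      by_cases hiz : (i : ℕ) ≤ z
      · rcases hi.2 with ⟨ho, ⟨-, h3⟩ | ⟨j, hj, -, h3⟩⟩ | ⟨ho, h3, h4⟩
        · omega
        · omega
        -- Player 1 owns β i, so i is odd, and the exit to α (i-1), which lies below α z, escapes
        -- attraction.
        · have := h4 ⟨i - 1, by omega⟩ (by simp; omega) (h.low _ (by simp; omega)).1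
          simp at this; omega
      · grind
    · have h1 := h.high
      simp [γ_mem_pre, RightAttracted] at hi ⊢
      grind
  · have hβ : ∀ i : Fin (2 * K + 1), z ≤ i → (i : ℕ) % 2 = 0 → β i ∈ S →
        β i ∈ (coreGame K).win (coreChild K S z Side.L) 0 := by
      intro i hi hi' hS
      rw [h.mem_win, h.mem_coreChild_left]
      simp [LeftAttracted, hS, hi, hi']; omega
    have htop : α ⟨z, by omega⟩ ∈
        (coreGame K).atr S 0 ((coreGame K).win (coreChild K S z Side.L) 0) := by
      have h1 := (h.low ⟨z, by omega⟩ le_rfl)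
      refine pre_atr_subset (α_mem_pre.mpr ⟨h1.1, Or.inl ⟨?_, h1.2.1, ?_⟩⟩)
      · simpa using hev
      · exact mem_atr_of_mem (hβ _ le_rfl hev h1.2.1) h1.2.1
    rintro (i | i | i) hi hP
    · convert htop
      exact hP
    · rcases hP with ⟨h1, h2⟩ | ⟨h1, h2⟩
      · exact mem_atr_of_mem (hβ i h1 h2 hi) hi
      · refine pre_atr_subset (β_mem_pre.mpr ⟨hi, Or.inr ⟨by simp; omega, by simp [h2], ?_⟩⟩)
        intro j hj _
        convert htop
        omega
    · rcases hP with ⟨h1, h2⟩ | h1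
      · refine mem_atr_of_mem ?_ hi
        rw [h.mem_win, h.mem_coreChild_left]
        simp [LeftAttracted, hi, h1, h2]
      · refine pre_atr_subset (γ_mem_pre.mpr ⟨hi, Or.inl ⟨by simp; omega, Or.inr (Or.inr
          ⟨_, ?_, ?_, htop⟩)⟩⟩)
        · exact h1.symm
        · exact (h.low _ le_rfl).1

theorem IsTreeShape.mem_coreChild_right (h : IsTreeShape z S) (v : CorePos K) :
    v ∈ coreChild K S z Side.R ↔ v ∈ S ∧ ¬ RightAttracted z S v := by
  classical
  change v ∈ (coreGame K).remove S ((coreGame K).atr S 0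
    ((coreGame K).win (coreChild K S z Side.L) 0)) ↔ _
  rw [remove_atr h.isSubgame, Finset.mem_sdiff, h.mem_atr_zero]
  tauto

theorem IsTreeShape.isHatShape_right (h : IsTreeShape z S) :
    IsHatShape z (coreChild K S z Side.R) where
  even := h.even
  le := h.le
  low i hi := by
    have := h.low i hi.le
    simp [h.mem_coreChild_right, RightAttracted, this]; omega
  low_γ i hi := by
    have := h.low i (by omega)
    simp [h.mem_coreChild_right, RightAttracted, this]; omega
  high i hi := by
    have := h.high i
    simp [h.mem_coreChild_right, RightAttracted]; grind
  tail i hi := by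
    have := h.tail i
    have := h.low i
    simp [h.mem_coreChild_right, RightAttracted]; grind

theorem IsTreeShape.isHatShape (h : IsTreeShape z S) (x : Side) :
    IsHatShape z (coreChild K S z x) := by
  cases x
  exacts [h.isHatShape_left, h.isHatShape_right]

/-! ### The left subgame of a child -/

/-- The positions attracted by player `0` to `α (z + 1)` in a child with index `z + 2`. -/
def HatAttracted (z : ℕ) : CorePos K → Prop
  | α i => (i : ℕ) = z + 1
  | β i => (i : ℕ) = z + 2
  | γ _ => False

/-- Player 0 owns β (z+2) and moves it to α (z+1), while player 1 avoids α (z+1) by looping at γ z.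
-/
theorem IsHatShape.mem_atr (h : IsHatShape (z + 2) H) (v : CorePos K) :
    v ∈ (coreGame K).atr H 0 (alphaSet K (z + 1)) ↔ v ∈ H ∧ HatAttracted z v := by
  have hev := h.even
  have hle := h.le
  have hz : z + 1 ≤ 2 * K := by omega
  have htopH : α ⟨z + 1, by omega⟩ ∈ H := (h.low _ (by simp)).1
  refine mem_atr_iff ?_ ?_ ?_ v
  · intro v _ hv
    rw [mem_alphaSet hz] at hv
    simp [hv, HatAttracted]
  · rintro (i | i | i) hi
    · have h1 := h.low i
      have h2 := h.high i
      simp [α_mem_pre, HatAttracted] at hi ⊢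
      grind
    · have h1 := h.low_γ i
      have h2 := h.tail i
      by_contra hP
      simp [HatAttracted] at hP
      simp [β_mem_pre, HatAttracted] at hi
      rcases hi.2 with ⟨ho, j, hj, -, h3⟩ | ⟨ho, h3, h4⟩
      · omega
      -- In a right child γ (z+1) is absent; then only the exit to α z protects β (z+1).
      · by_cases hiz : (i : ℕ) = z + 1
        · have := h4 ⟨z, by omega⟩ (by simp [hiz]) (h.low _ (by simp)).1
          simp at this
        · grind
    · simp [γ_mem_pre, HatAttracted] at hi
      grind
  · have htop : α ⟨z + 1, by omega⟩ ∈ (coreGame K).atr H 0 (alphaSet K (z + 1)) :=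
      mem_atr_of_mem ((mem_alphaSet hz).mpr rfl) htopH
    rintro (i | i | i) hi hP
    · convert htop
      exact hP
    · refine pre_atr_subset (β_mem_pre.mpr ⟨hi, Or.inl ⟨?_, Or.inr ⟨_, ?_, htopH, htop⟩⟩⟩)
      · simp only [HatAttracted] at hP
        simp; omega
      · exact hP.symm
    · exact hP.elim

theorem IsHatShape.mem_remove (h : IsHatShape (z + 2) H) (v : CorePos K) :
    v ∈ (coreGame K).remove H ((coreGame K).atr H 0 (alphaSet K (z + 1))) ↔
      v ∈ H ∧ ¬ HatAttracted z v := by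
  classical
  rw [remove_atr h.isSubgame, Finset.mem_sdiff, h.mem_atr]
  tauto

theorem IsHatShape.isTreeShape_remove (h : IsHatShape (z + 2) H) :
    IsTreeShape z ((coreGame K).remove H ((coreGame K).atr H 0 (alphaSet K (z + 1)))) where
  even := by have := h.even; omega
  le := by have := h.le; omega
  low i hi := by
    have h1 := h.low i (by omega)
    have h2 := h.low_γ i (by omega)
    simp [h.mem_remove, HatAttracted, h1, h2]; omega
  high i hi := by
    have := h.high i
    simp [h.mem_remove, HatAttracted]; grind
  tail i hi := by
    have := h.tail i
    simp [h.mem_remove, HatAttracted]; grind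

/-! ### The recursive calls -/

theorem IsHatShape.callAt_left (h : IsHatShape (z + 2) H) :
    (coreGame K).callAt H [Side.L] =
      some ((coreGame K).remove H ((coreGame K).atr H 0 (alphaSet K (z + 1)))) := by
  have hev := h.even
  have hle := h.le
  have htop : α ⟨z + 1, by omega⟩ ∈ H := (h.low _ (by simp)).1
  rw [ParityGame.callAt_left (Finset.ne_empty_of_mem htop), callAt,
    (left_eq_of_top (z := z + 1) (p := 0) (by omega) htop (fun i hi => ?_) (by simp; omega)).2]
  by_contra! hlt
  exact h.high i (by omega) hi

/-- The right call is executed because α z, absent from the left child, belongs to player 0 and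
moves to β z, which player 0 wins there. -/
theorem IsTreeShape.callAt_singleton (h : IsTreeShape z S) (x : Side) :
    (coreGame K).callAt S [x] = some (coreChild K S z x) := by
  classical
  have hev := h.even
  have hle := h.le
  have htop := h.low ⟨z, by omega⟩ le_rfl
  have hne := Finset.ne_empty_of_mem htop.1
  obtain ⟨hlead, hleft⟩ := left_eq_of_top (p := 1) hle htop.1 (fun i hi => by
    by_contra! hlt
    exact h.high i hlt hi) (by simp; omega)
  change _ = coreChild K S z Side.L at hleft
  cases x with
  | L => rw [ParityGame.callAt_left hne, callAt, hleft]
  | R =>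
    have hwin := sol_eq_win h.isHatShape_left.isSubgame 0
    have hst : ¬ (coreGame K).Stable S ((coreGame K).win (coreChild K S z Side.L) 0) 0 := by
      rw [Stable, Finset.sdiff_eq_empty_iff_subset]
      intro hsub
      have : α ⟨z, by omega⟩ ∈ (coreGame K).pre S 0
          ((coreGame K).win (coreChild K S z Side.L) 0) := by
        refine α_mem_pre.mpr ⟨htop.1, Or.inl ⟨by simpa using hev, htop.2.1, ?_⟩⟩
        rw [h.mem_win, h.mem_coreChild_left]
        simp [htop.2.1, LeftAttracted, hev]
      have := hsub this
      rw [h.mem_win, h.mem_coreChild_left] at this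
      simp [LeftAttracted] at this
    rw [ParityGame.callAt_right hne (by rwa [hlead, hleft, opp_one, hwin]), hlead, hleft, opp_one,
      hwin]
    rfl

end ParityGame

/-! ### Cardinalities of directions and positions -/

instance : Fintype Side := ⟨⟨[Side.L, Side.R], by simp⟩, fun x => by cases x <;> simp⟩

theorem Side.card : Fintype.card Side = 2 := rfl

namespace CorePos

variable {K : ℕ}

def equivSum (k : ℕ) : CorePos k ≃ Fin (2 * k + 1) ⊕ Fin (2 * k + 1) ⊕ Fin (2 * k + 1) where
  toFun
    | α i => Sum.inl i
    | β i => Sum.inr (Sum.inl i)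
    | γ i => Sum.inr (Sum.inr i)
  invFun := Sum.elim α (Sum.elim β γ)
  left_inv v := by cases v <;> rfl
  right_inv v := by rcases v with i | i | i <;> rfl

theorem card_eq (k : ℕ) : Fintype.card (CorePos k) = 6 * k + 3 := by
  rw [Fintype.card_congr (equivSum k)]
  simp
  omega

end CorePos

namespace ParityGame

open CorePos

variable {K k z : ℕ} {S S₀ : Finset (CorePos K)}

/-! ### The subgame tree below a subgame of tree shape -/

/-- The subgames `G_w`, for the tree of depth `k` with root `S₀`. -/
noncomputable def subtreeGame (K k : ℕ) (S₀ : Finset (CorePos K)) :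
    List Side → Finset (CorePos K)
  | [] => S₀
  | x :: w =>
      let H := coreChild K (subtreeGame K k S₀ w) (2 * (k - w.length)) x
      (coreGame K).remove H ((coreGame K).atr H 0 (alphaSet K (2 * (k - (w.length + 1)) + 1)))

/-- The subgames `G_w` and `Ĝ_{w x}`, for the tree of depth `k` with root `S₀`. -/
noncomputable def subtreeNode (K k : ℕ) (S₀ : Finset (CorePos K)) (w : List Side) :
    Option Side → Finset (CorePos K)
  | none => subtreeGame K k S₀ w
  | some x => coreChild K (subtreeGame K k S₀ w) (2 * (k - w.length)) x

def subtree (K k : ℕ) (S₀ : Finset (CorePos K)) : Set (Finset (CorePos K)) :=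
  {S | ∃ w o, w.length ≤ k ∧ S = subtreeNode K k S₀ w o}

theorem treeGame_eq (w : List Side) : treeGame k w = subtreeGame k k Finset.univ w := by
  induction w with
  | nil => rfl
  | cons x w ih => rw [treeGame, subtreeGame, ih]

theorem inducedSubgameTree_eq : inducedSubgameTree k = subtree k k Finset.univ := by
  ext S
  constructor
  · rintro (⟨w, hw, rfl⟩ | ⟨w, x, hw, rfl⟩)
    · exact ⟨w, none, hw, treeGame_eq w⟩
    · exact ⟨w, some x, hw, by rw [treeHat, treeGame_eq]; rfl⟩
  · rintro ⟨w, _ | x, hw, rfl⟩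
    · exact Or.inl ⟨w, hw, (treeGame_eq w).symm⟩
    · exact Or.inr ⟨w, x, hw, by rw [treeHat, treeGame_eq]; rfl⟩

theorem isTreeShape_univ : IsTreeShape (2 * k) (Finset.univ : Finset (CorePos k)) where
  even := by omega
  le := le_rfl
  low i _ := by simp
  high i hi := by omega
  tail i _ _ := by simp

theorem IsTreeShape.subtreeGame (h : IsTreeShape (2 * k) S₀) {w : List Side}
    (hw : w.length ≤ k) : IsTreeShape (2 * (k - w.length)) (subtreeGame K k S₀ w) := by
  induction w with
  | nil => exact h
  | cons x w ih =>
    rw [List.length_cons] at hw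
    have hH := (ih (by omega)).isHatShape x
    rw [show 2 * (k - w.length) = 2 * (k - (w.length + 1)) + 2 by omega] at hH
    rw [ParityGame.subtreeGame, show 2 * (k - w.length) = 2 * (k - (w.length + 1)) + 2 by omega]
    exact hH.isTreeShape_remove

theorem callAt_treePath (h : IsTreeShape (2 * k) S₀) {w : List Side} (hw : w.length ≤ k) :
    (coreGame K).callAt S₀ (treePath w) = some (subtreeGame K k S₀ w) := by
  induction w with
  | nil => simp [treePath, callAt, subtreeGame]
  | cons x w ih =>
    rw [List.length_cons] at hw
    have hS := h.subtreeGame (w := w) (by omega)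
    have hH := hS.isHatShape x
    rw [treePath, callAt_append, ih (by omega), Option.bind_some,
      show [x, Side.L] = [x] ++ [Side.L] from rfl, callAt_append, hS.callAt_singleton,
      Option.bind_some]
    rw [subtreeGame]
    rw [show 2 * (k - w.length) = 2 * (k - (w.length + 1)) + 2 by omega] at hH ⊢
    exact hH.callAt_left

theorem callAt_treePath_append (h : IsTreeShape (2 * k) S₀) {w : List Side} (hw : w.length ≤ k)
    (x : Side) : (coreGame K).callAt S₀ (treePath w ++ [x]) =
      some (coreChild K (subtreeGame K k S₀ w) (2 * (k - w.length)) x) := by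
  rw [callAt_append, callAt_treePath h hw, Option.bind_some,
    (h.subtreeGame hw).callAt_singleton]

theorem subtree_subset (h : IsTreeShape (2 * k) S₀) :
    subtree K k S₀ ⊆ {T | ∃ path, (coreGame K).callAt S₀ path = some T} := by
  rintro S ⟨w, _ | x, hw, rfl⟩
  · exact ⟨_, callAt_treePath h hw⟩
  · exact ⟨_, callAt_treePath_append h hw x⟩

/-! ### Distinctness -/

/-- Above z the right attractor takes only γ-positions of even index, so the odd ones preserve the
record of earlier choices. -/
theorem IsTreeShape.γ_mem_coreChild (h : IsTreeShape z S) (x : Side) {i : Fin (2 * K + 1)}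
    (hi : z < i) (hodd : (i : ℕ) % 2 = 1) : γ i ∈ coreChild K S z x ↔ γ i ∈ S := by
  cases x
  · simp [h.mem_coreChild_left, LeftAttracted]
  · simp [h.mem_coreChild_right, RightAttracted]
    omega

theorem IsTreeShape.γ_mem_coreChild_iff (h : IsTreeShape z S) (x : Side) {i : Fin (2 * K + 1)}
    (hi : (i : ℕ) = z ∨ (i : ℕ) + 1 = z) : γ i ∈ coreChild K S z x ↔ x = Side.L := by
  have hev := h.even
  cases x
  · have := h.low i (by omega)
    simp [h.mem_coreChild_left, LeftAttracted, this]
  · simp [h.mem_coreChild_right, RightAttracted]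
    omega

theorem γ_mem_subtreeGame_cons (h : IsTreeShape (2 * k) S₀) {w : List Side} (x : Side)
    (hw : w.length + 1 ≤ k) (i : Fin (2 * K + 1)) :
    γ i ∈ subtreeGame K k S₀ (x :: w) ↔
      γ i ∈ coreChild K (subtreeGame K k S₀ w) (2 * (k - w.length)) x := by
  have hH := (h.subtreeGame (w := w) (by omega)).isHatShape x
  rw [subtreeGame]
  rw [show 2 * (k - w.length) = 2 * (k - (w.length + 1)) + 2 by omega] at hH ⊢
  simp [hH.mem_remove, HatAttracted]

/-- The words of a given length are determined by the `γ`-positions of odd index. -/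
theorem eq_of_γ_mem_iff (h : IsTreeShape (2 * k) S₀) {w w' : List Side} (hw : w.length ≤ k)
    (hlen : w.length = w'.length)
    (hγ : ∀ i : Fin (2 * K + 1), 2 * (k - w.length) < i → (i : ℕ) % 2 = 1 →
      (γ i ∈ subtreeGame K k S₀ w ↔ γ i ∈ subtreeGame K k S₀ w')) : w = w' := by
  induction w generalizing w' with
  | nil => exact (List.length_eq_zero_iff.mp hlen.symm).symm
  | cons x w ih =>
    rcases w' with _ | ⟨x', w'⟩
    · simp at hlen
    simp only [List.length_cons, add_left_inj] at hlen hw hγ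
    have hle := h.le
    have hS := h.subtreeGame (w := w) (by omega)
    have hS' := h.subtreeGame (w := w') (by omega)
    simp only [γ_mem_subtreeGame_cons h x hw, γ_mem_subtreeGame_cons h x' (hlen ▸ hw),
      ← hlen] at hγ
    rw [← hlen] at hS'
    have hx : x = x' := by
      -- With z = 2(k - |w|), the position γ (z-1) records the last letter. Even γ-positions are
      -- unsuitable, as later right calls erase them.
      have := hγ ⟨2 * (k - w.length) - 1, by omega⟩ (by simp; omega) (by simp; omega)
      rw [hS.γ_mem_coreChild_iff x (Or.inr (by simp; omega)),
        hS'.γ_mem_coreChild_iff x' (Or.inr (by simp; omega))] at this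
      cases x <;> cases x' <;> simp_all
    rw [hx, ih (by omega) hlen fun i hi hodd => ?_]
    have := hγ i (by omega) hodd
    rwa [hS.γ_mem_coreChild x hi hodd, hS'.γ_mem_coreChild x' hi hodd] at this

theorem α_mem_subtreeNode (h : IsTreeShape (2 * k) S₀) {w : List Side} (hw : w.length ≤ k)
    (o : Option Side) (i : Fin (2 * K + 1)) : α i ∈ subtreeNode K k S₀ w o ↔
      (i : ℕ) < 2 * (k - w.length) + if o = none then 1 else 0 := by
  have hS := h.subtreeGame hw
  rcases o with _ | x
  · have h1 := hS.low i
    have h2 := hS.high i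
    simp [subtreeNode]
    grind
  · have h1 := (hS.isHatShape x).low i
    have h2 := (hS.isHatShape x).high i
    simp [subtreeNode]
    grind

/-- The number of α-positions is odd for G_w and even for its children, and determines the length of
`w`; the γ-positions determine the letters. -/
theorem subtreeNode_injective (h : IsTreeShape (2 * k) S₀) {w w' : List Side} {o o' : Option Side}
    (hw : w.length ≤ k) (hw' : w'.length ≤ k)
    (heq : subtreeNode K k S₀ w o = subtreeNode K k S₀ w' o') : w = w' ∧ o = o' := by
  have hle := h.le
  have hα (i : ℕ) (hi : i < 2 * K + 1) := (α_mem_subtreeNode h hw o ⟨i, hi⟩).symm.trans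
    (heq ▸ α_mem_subtreeNode h hw' o' ⟨i, hi⟩)
  simp only at hα
  have hthr : 2 * (k - w.length) + (if o = none then 1 else 0) =
      2 * (k - w'.length) + (if o' = none then 1 else 0) := by
    -- If the thresholds differed, the α whose index is the smaller one would lie in just one of the
    -- two nodes.
    rcases lt_trichotomy (2 * (k - w.length) + (if o = none then 1 else 0))
      (2 * (k - w'.length) + (if o' = none then 1 else 0)) with hlt | heq | hlt
    · exact absurd ((hα _ (by split_ifs at hlt ⊢ <;> omega)).mpr hlt) (lt_irrefl _)
    · exact heq
    · exact absurd ((hα _ (by split_ifs at hlt ⊢ <;> omega)).mp hlt) (lt_irrefl _)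
  have hlen : w.length = w'.length := by split_ifs at hthr <;> omega
  have hS := h.subtreeGame hw
  have hS' := h.subtreeGame hw'
  rw [← hlen] at hS'
  rcases o with _ | x <;> rcases o' with _ | x'
  · refine ⟨eq_of_γ_mem_iff h hw hlen fun i _ _ => ?_, rfl⟩
    simp only [subtreeNode] at heq
    rw [heq]
  · simp at hthr; omega
  · simp at hthr; omega
  · simp only [subtreeNode, ← hlen] at heq
    have hx : x = x' := by
      -- The final letter is read at γ z, since at the deepest level z = 0 there is no γ (z-1).
      have := hS.γ_mem_coreChild_iff x (i := ⟨2 * (k - w.length), by omega⟩) (Or.inl rfl)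
      rw [heq, hS'.γ_mem_coreChild_iff x' (Or.inl rfl)] at this
      cases x <;> cases x' <;> simp_all
    refine ⟨eq_of_γ_mem_iff h hw hlen fun i hi hodd => ?_, by rw [hx]⟩
    rw [← hS.γ_mem_coreChild x hi hodd, heq, hS'.γ_mem_coreChild x' hi hodd]

theorem ncard_subtree (h : IsTreeShape (2 * k) S₀) :
    (subtree K k S₀).ncard = 3 * (2 ^ (k + 1) - 1) := by
  let f : (Σ m : Fin (k + 1), List.Vector Side m × Option Side) → Finset (CorePos K) :=
    fun x => subtreeNode K k S₀ x.2.1.1 x.2.2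
  have hf : Function.Injective f := by
    rintro ⟨m, ⟨w, hw⟩, o⟩ ⟨m', ⟨w', hw'⟩, o'⟩ heq
    obtain ⟨rfl, rfl⟩ := subtreeNode_injective h (hw.trans_le (by omega))
      (hw'.trans_le (by omega)) heq
    obtain rfl : m = m' := Fin.ext (hw.symm.trans hw')
    rfl
  have hrange : subtree K k S₀ = Set.range f := by
    ext S
    constructor
    · rintro ⟨w, o, hw, rfl⟩
      exact ⟨⟨⟨w.length, by omega⟩, ⟨w, rfl⟩, o⟩, rfl⟩
    · rintro ⟨⟨m, ⟨w, hw⟩, o⟩, rfl⟩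
      exact ⟨w, o, hw.trans_le (by omega), rfl⟩
  rw [hrange, ← Set.image_univ, Set.ncard_image_of_injective _ hf, Set.ncard_univ,
    Nat.card_eq_fintype_card, Fintype.card_sigma]
  simp only [Fintype.card_prod, card_vector, Fintype.card_option, Side.card]
  rw [← Finset.sum_mul, Fin.sum_univ_eq_sum_range (fun i => 2 ^ i), Nat.geomSum_eq le_rfl]
  simp [mul_comm]

theorem le_ncard_calls (h : IsTreeShape (2 * k) S₀) : 3 * (2 ^ (k + 1) - 1) ≤
    {T | ∃ path, (coreGame K).callAt S₀ path = some T}.ncard := by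
  rw [← ncard_subtree h]
  exact Set.ncard_le_ncard (subtree_subset h) (Set.toFinite _)

/-! ### Games with an arbitrary number of positions -/

/-- The positions of the core game of index `k` and `r` isolated positions, within a larger core
game. -/
def padding (k r : ℕ) : CorePos k ⊕ Fin r ↪ CorePos (k + r + 1) where
  toFun
    | Sum.inl (α i) => α (i.castLE (by omega))
    | Sum.inl (β i) => β (i.castLE (by omega))
    | Sum.inl (γ i) => γ (i.castLE (by omega))
    | Sum.inr j => γ ⟨2 * k + 3 + 2 * j, by omega⟩
  inj' := by
    rintro ((i | i | i) | i) ((j | j | j) | j) h <;> simp [Fin.ext_iff] at h ⊢ <;> omega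

/-- Above index 2k only the isolated γ-positions occur, so the conditions on α and β there hold
vacuously. -/
theorem isTreeShape_padding {V : Type*} [Fintype V] (k r : ℕ) (e : V ≃ CorePos k ⊕ Fin r) :
    IsTreeShape (2 * k) (Finset.univ.map (e.toEmbedding.trans (padding k r))) := by
  have hmem (v) : v ∈ Finset.univ.map (e.toEmbedding.trans (padding k r)) ↔
      ∃ x, padding k r x = v := by
    simp only [Finset.mem_map, Finset.mem_univ, true_and]
    exact e.surjective.exists (p := fun x => padding k r x = v).symm
  refine ⟨by omega, by omega, fun i hi => ?_, fun i hi h => ?_, fun i hi h => ?_⟩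
  · simp only [hmem]
    exact ⟨⟨Sum.inl (α ⟨i, by omega⟩), rfl⟩, ⟨Sum.inl (β ⟨i, by omega⟩), rfl⟩,
      ⟨Sum.inl (γ ⟨i, by omega⟩), rfl⟩⟩
  · obtain ⟨(j | j | j) | j, hj⟩ := (hmem _).mp h <;> simp [padding] at hj
    have : (j : ℕ) = i := congrArg index hj
    omega
  · obtain ⟨(j | j | j) | j, hj⟩ := (hmem _).mp h <;> simp [padding] at hj
    have : (j : ℕ) = i := congrArg index hj
    omega

theorem exists_le_ncard_calls (k r n : ℕ) (hn : n = 6 * k + 3 + r) :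
    ∃ G : ParityGame (Fin n), 3 * (2 ^ (k + 1) - 1) ≤ G.calls.ncard := by
  have e : Fin n ≃ CorePos k ⊕ Fin r := Fintype.equivOfCardEq (by simp [card_eq, hn])
  have hS := isTreeShape_padding k r e
  refine ⟨(coreGame _).induce _ hS.isSubgame, ?_⟩
  rw [← ncard_callAt_induce]
  exact le_ncard_calls hS

theorem ncard_calls_le_ncard_memoCalls {V : Type*} [Fintype V] (G : ParityGame V) :
    G.calls.ncard ≤ G.memoCalls.ncard :=
  Set.ncard_le_ncard calls_subset_memoCalls (Set.toFinite _)

theorem half_mul_two_rpow_le (n : ℕ) :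
    1 / 2 * (2 : ℝ) ^ ((n : ℝ) / 6) ≤ ((3 * (2 ^ ((n - 3) / 6 + 1) - 1) : ℕ) : ℝ) := by
  set k := (n - 3) / 6 with hk
  -- From n ≤ 6k + 8 the exponent is below k + 2. The factor 1/2 leaves 2^(k+1), which is at most
  -- 3(2^(k+1) - 1).
  have h1 : (n : ℝ) / 6 ≤ ((k + 2 : ℕ) : ℝ) := by
    rw [div_le_iff₀ (by norm_num)]
    exact_mod_cast (by omega : n ≤ (k + 2) * 6)
  have h2 : (2 : ℝ) ^ ((n : ℝ) / 6) ≤ 2 ^ (k + 2) := by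
    rw [← Real.rpow_natCast]
    exact Real.rpow_le_rpow_of_exponent_le (by norm_num) h1
  have h3 : 2 ^ (k + 1) ≤ 3 * (2 ^ (k + 1) - 1) := by
    have : 0 < 2 ^ k := by positivity
    rw [pow_succ]
    omega
  calc 1 / 2 * (2 : ℝ) ^ ((n : ℝ) / 6) ≤ 1 / 2 * 2 ^ (k + 2) := by gcongr
    _ = ((2 ^ (k + 1) : ℕ) : ℝ) := by push_cast; ring
    _ ≤ _ := by exact_mod_cast h3

end ParityGame

/-! ### The exponential worst case -/

open ParityGame

theorem theorem1 :
    -- worst-case lower bound, without and with memoization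
    (∃ c : ℝ, 0 < c ∧ ∀ᶠ n : ℕ in Filter.atTop, ∃ G : ParityGame (Fin n),
      c * (2 : ℝ) ^ ((n : ℝ) / 6) ≤ (G.calls.ncard : ℝ) ∧
      c * (2 : ℝ) ^ ((n : ℝ) / 6) ≤ (G.memoCalls.ncard : ℝ)) ∧
    -- the core family as witness
    (∀ k : ℕ, 1 ≤ k →
      Fintype.card (CorePos k) = 6 * k + 3 ∧
      -- the induced subgame tree embeds in the recursion tree
      (∀ w : List Side, w.length ≤ k →
        (coreGame k).callAt Finset.univ (treePath w) = some (treeGame k w) ∧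
        ∀ x : Side,
          (coreGame k).callAt Finset.univ (treePath w ++ [x]) = some (treeHat k w x)) ∧
      -- the number of distinct subgames in it
      (inducedSubgameTree k).ncard = 3 * (2 ^ (k + 1) - 1) ∧
      -- all of them are solved, without and with memoization
      inducedSubgameTree k ⊆ (coreGame k).calls ∧
      inducedSubgameTree k ⊆ (coreGame k).memoCalls ∧
      3 * (2 ^ (k + 1) - 1) ≤ (coreGame k).calls.ncard ∧
      3 * (2 ^ (k + 1) - 1) ≤ (coreGame k).memoCalls.ncard) := by
  refine ⟨⟨1 / 2, by norm_num, ?_⟩, fun k _ => ?_⟩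
  -- For n ≥ 3, division of n - 3 by 6 gives n = 6k + 3 + r with r isolated positions.
  · filter_upwards [eventually_ge_atTop 3] with n hn
    obtain ⟨G, hG⟩ := exists_le_ncard_calls ((n - 3) / 6) ((n - 3) % 6) n (by omega)
    refine ⟨G, (half_mul_two_rpow_le n).trans ?_, (half_mul_two_rpow_le n).trans ?_⟩
    · exact_mod_cast hG
    · exact_mod_cast hG.trans (ncard_calls_le_ncard_memoCalls G)
  · have hu := isTreeShape_univ (k := k)
    have hsub : inducedSubgameTree k ⊆ (coreGame k).calls := by
      rw [inducedSubgameTree_eq]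
      exact subtree_subset hu
    refine ⟨CorePos.card_eq k, fun w hw => ⟨?_, fun x => ?_⟩, ?_, hsub,
      hsub.trans calls_subset_memoCalls, le_ncard_calls hu,
      (le_ncard_calls hu).trans (ncard_calls_le_ncard_memoCalls _)⟩
    · rw [treeGame_eq, callAt_treePath hu hw]
    · rw [treeHat, treeGame_eq, callAt_treePath_append hu hw]
    · rw [inducedSubgameTree_eq, ncard_subtree hu]
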